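/- Let $N\ge 1$. Let $\dot H^1=\dot H^1(e^{-|x|^2/2}dx)$ be the space of (real-valued) locally integrable functions $\psi$ on $\mathbb{R}^N$ that have a weak gradient with $$\|\psi\|_{\dot H^1}^2=\int_{\mathbb{R}^N}|\nabla\psi|^2e^{-|x|^2/2}\,dx<\infty ,$$ functions that differ (almost everywhere) only by an additive constant being identified. Let $\mathcal H$ be the Ornstein--Uhlenbeck operator $\mathcal H\psi=-\Delta\psi+x\cdot\nabla\psi$ in $\dot H^1$ with domain $$\mathcal D(\mathcal H)=\{\psi\in H^3_{\mathrm{loc}}(\mathbb{R}^N):\ \psi\in\dot H^1,\ -\Delta\psi+x\cdot\nabla\psi\in\dot H^1\}.$$ Then $\dot H^1$ is a Hilbert space and $\mathcal H:\mathcal D(\mathcal H)\to\dot H^1$ is self-adjoint. Its spectrum is purely discrete (it has no finite accumulation point and each of its points is an eigenvalue of finite multiplicity) and is the set of positive integers, $$\sigma(\mathcal H)=\{1,2,3,\dots\}.$$ The corresponding eigenfunctions are Hermite polynomials: let $\psi_0(z)=1$, $\psi_{n+1}(z)=z\psi_n(z)-\psi_n'(z)$ for $z\in\mathbb{R}$,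 and $\psi_\alpha(x)=\psi_{\alpha_1}(x_1)\cdots\psi_{\alpha_N}(x_N)$ for multi-indices $\alpha\in\mathbb{N}_0^N$. Then for every $\alpha\ne0$ the function $\psi_\alpha$ is an eigenfunction of $\mathcal H$ with eigenvalue $|\alpha|=\alpha_1+\dots+\alpha_N$, and for every $n\ge1$ the eigenspace of $\mathcal H$ for the eigenvalue $n$ is the linear span of (the classes of) the $\psi_\alpha$ with $|\alpha|=n$. -/

import Mathlib

open MeasureTheory Filter Topology
open scoped ContDiff

noncomputable section

namespace GaussSob

/-! ### Unbounded operators: spectrum, eigenspaces, discreteness -/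

section Operators

variable {V : Type*} [NormedAddCommGroup V] [NormedSpace ℝ V]

/-- `z` is in the resolvent set of the (unbounded) operator `T` if `T - z` is a bijection from the
domain of `T` onto the whole space whose inverse `R` is bounded and everywhere defined. -/
def IsResolventPoint (T : V →ₗ.[ℝ] V) (z : ℝ) : Prop :=
  ∃ R : V →L[ℝ] V,
    (∀ y : V, ∃ h : R y ∈ T.domain, T ⟨R y, h⟩ - z • R y = y) ∧
    ∀ x : T.domain, R (T x - z • (x : V)) = x

/-- The spectrum of an (unbounded) operator: the complement of its resolvent set. -/
def unboundedSpectrum (T : V →ₗ.[ℝ] V) : Set ℝ := {z | ¬ IsResolventPoint T z}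

/-- The eigenspace `{u ∈ D(T) : T u = z u}` of an (unbounded) operator. -/
def eigenspace (T : V →ₗ.[ℝ] V) (z : ℝ) : Submodule ℝ V where
  carrier := {u | ∃ h : u ∈ T.domain, T ⟨u, h⟩ = z • u}
  zero_mem' := ⟨T.domain.zero_mem, by
    rw [smul_zero]
    exact T.map_zero⟩
  add_mem' := by
    rintro a b ⟨ha, ha'⟩ ⟨hb, hb'⟩
    refine ⟨T.domain.add_mem ha hb, ?_⟩
    rw [smul_add, ← ha', ← hb']
    exact T.map_add ⟨a, ha⟩ ⟨b, hb⟩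
  smul_mem' := by
    rintro c a ⟨ha, ha'⟩
    refine ⟨T.domain.smul_mem c ha, ?_⟩
    rw [smul_comm, ← ha']
    exact T.map_smul c ⟨a, ha⟩

/-- The spectrum is purely discrete: every spectral point is an eigenvalue of finite multiplicity,
and the spectrum has no finite accumulation point. -/
def HasPurelyDiscreteSpectrum (T : V →ₗ.[ℝ] V) : Prop :=
  (∀ z ∈ unboundedSpectrum T, eigenspace T z ≠ ⊥ ∧ FiniteDimensional ℝ (eigenspace T z)) ∧
  ∀ z : ℝ, ¬ AccPt z (𝓟 (unboundedSpectrum T))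

end Operators

/-! ### Weak derivatives -/

/-- The Euclidean space `ℝ^N`. -/
abbrev Sp (N : ℕ) : Type := EuclideanSpace ℝ (Fin N)

variable {N : ℕ}

/-- `g` is the `i`-th weak partial derivative of `ψ` on `ℝ^N`. -/
structure HasWeakPartial (i : Fin N) (ψ g : Sp N → ℝ) : Prop where
  locInt_fun : LocallyIntegrable ψ volume
  locInt_deriv : LocallyIntegrable g volume
  integral_eq : ∀ φ : Sp N → ℝ, ContDiff ℝ ∞ φ → HasCompactSupport φ →
    ∫ x, ψ x * fderiv ℝ φ x (EuclideanSpace.single i 1) = - ∫ x, g x * φ x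

/-- The vector field `G` is the weak gradient of `ψ`. -/
def HasWeakGradient (ψ : Sp N → ℝ) (G : Sp N → Sp N) : Prop :=
  ∀ i, HasWeakPartial i ψ (fun x => G x i)

/-- Local square integrability. -/
def MemL2loc (ψ : Sp N → ℝ) : Prop :=
  ∀ K : Set (Sp N), IsCompact K → MemLp ψ 2 (volume.restrict K)

/-- The local Sobolev space `H^k_loc(ℝ^N)`: all weak derivatives of order at most `k` exist and are
locally square integrable. -/
def MemHloc : ℕ → (Sp N → ℝ) → Prop
  | 0, ψ => MemL2loc ψ
  | k + 1, ψ => MemL2loc ψ ∧ ∀ i, ∃ g, HasWeakPartial i ψ g ∧ MemHloc k g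

lemma integrable_mul_test {ψ φ : Sp N → ℝ} (hψ : LocallyIntegrable ψ volume)
    (hφ : Continuous φ) (hc : HasCompactSupport φ) : Integrable (fun x => ψ x * φ x) := by
  simpa [mul_comm] using hψ.integrable_smul_left_of_hasCompactSupport hφ hc

lemma integrable_mul_fderiv_test {ψ φ : Sp N → ℝ} (hψ : LocallyIntegrable ψ volume)
    (hφ : ContDiff ℝ ∞ φ) (hc : HasCompactSupport φ) (v : Sp N) :
    Integrable (fun x => ψ x * fderiv ℝ φ x v) := by
  refine integrable_mul_test hψ ?_ (hc.fderiv_apply ℝ v)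
  exact (hφ.continuous_fderiv (by simp)).clm_apply continuous_const

lemma HasWeakPartial.add {i : Fin N} {ψ₁ ψ₂ g₁ g₂ : Sp N → ℝ} (h₁ : HasWeakPartial i ψ₁ g₁)
    (h₂ : HasWeakPartial i ψ₂ g₂) :
    HasWeakPartial i (fun x => ψ₁ x + ψ₂ x) (fun x => g₁ x + g₂ x) := by
  refine ⟨h₁.1.add h₂.1, h₁.2.add h₂.2, fun φ hφ hc => ?_⟩
  simp only [add_mul]
  rw [integral_add (integrable_mul_fderiv_test h₁.1 hφ hc _)
      (integrable_mul_fderiv_test h₂.1 hφ hc _),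
    integral_add (integrable_mul_test h₁.2 hφ.continuous hc)
      (integrable_mul_test h₂.2 hφ.continuous hc),
    h₁.3 φ hφ hc, h₂.3 φ hφ hc]
  ring

lemma HasWeakPartial.smul {i : Fin N} {ψ g : Sp N → ℝ} (c : ℝ) (h : HasWeakPartial i ψ g) :
    HasWeakPartial i (fun x => c * ψ x) (fun x => c * g x) := by
  refine ⟨h.1.smul c, h.2.smul c, fun φ hφ hc => ?_⟩
  simp only [mul_assoc]
  rw [integral_const_mul, integral_const_mul, h.3 φ hφ hc]
  ring

lemma HasWeakPartial.unique {i : Fin N} {ψ₁ ψ₂ g₁ g₂ : Sp N → ℝ} (h₁ : HasWeakPartial i ψ₁ g₁)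
    (h₂ : HasWeakPartial i ψ₂ g₂) (h : ψ₁ =ᵐ[volume] ψ₂) : g₁ =ᵐ[volume] g₂ := by
  have key : ∀ᵐ x ∂(volume : Measure (Sp N)), (fun x => g₁ x - g₂ x) x = 0 := by
    refine ae_eq_zero_of_integral_contDiff_smul_eq_zero (h₁.2.sub h₂.2) fun φ hφ hc => ?_
    have e : (fun x => φ x • (fun x => g₁ x - g₂ x) x) = fun x => g₁ x * φ x - g₂ x * φ x := by
      funext x
      simp only [smul_eq_mul]
      ring
    rw [e, integral_sub (integrable_mul_test h₁.2 hφ.continuous hc)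
      (integrable_mul_test h₂.2 hφ.continuous hc)]
    have a₁ := h₁.3 φ hφ hc
    have a₂ := h₂.3 φ hφ hc
    have a₃ : ∫ x, ψ₁ x * fderiv ℝ φ x (EuclideanSpace.single i 1)
        = ∫ x, ψ₂ x * fderiv ℝ φ x (EuclideanSpace.single i 1) := by
      apply integral_congr_ae
      filter_upwards [h] with x hx
      rw [hx]
    linarith
  filter_upwards [key] with x hx
  exact sub_eq_zero.1 hx

lemma hasWeakPartial_const (i : Fin N) (c : ℝ) :
    HasWeakPartial i (fun _ : Sp N => c) (fun _ => 0) := by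
  refine ⟨locallyIntegrable_const c, locallyIntegrable_const 0, fun φ hφ hc => ?_⟩
  have := integral_mul_fderiv_eq_neg_fderiv_mul_of_integrable (μ := (volume : Measure (Sp N)))
    (f := fun _ : Sp N => c) (g := φ) (v := EuclideanSpace.single i 1) (by simp)
    (integrable_mul_fderiv_test (locallyIntegrable_const c) hφ hc _)
    (integrable_mul_test (locallyIntegrable_const c) hφ.continuous hc)
    (fun x _ => differentiableAt_const c) (fun x _ => hφ.differentiable (by simp) x)
  rw [this]
  simp

lemma integral_fderiv_mul_eq_zero {ψ f : Sp N → ℝ} {i : Fin N}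
    (h : HasWeakPartial i ψ (fun _ => 0)) (hfs : ContDiff ℝ ∞ f) (hfc : HasCompactSupport f)
    (x : Sp N) :
    ∫ t, fderiv ℝ f t (EuclideanSpace.single i 1) * ψ (x - t) = 0 := by
  have hφ : ContDiff ℝ ∞ (fun t => f (x - t)) := hfs.comp (contDiff_const.sub contDiff_id)
  have hφc : HasCompactSupport (fun t => f (x - t)) := hfc.comp_homeomorph (Homeomorph.subLeft x)
  have key := h.3 _ hφ hφc
  have hder : ∀ t, fderiv ℝ (fun t => f (x - t)) t (EuclideanSpace.single i 1)
      = - fderiv ℝ f (x - t) (EuclideanSpace.single i 1) := by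
    intro t
    have h₁ : HasFDerivAt (fun t : Sp N => x - t) (-(ContinuousLinearMap.id ℝ (Sp N))) t :=
      (hasFDerivAt_id t).const_sub x
    have h₂ := ((hfs.differentiable (by simp) (x - t)).hasFDerivAt).comp t h₁
    have h₃ : fderiv ℝ (fun t => f (x - t)) t = _ := h₂.fderiv
    rw [h₃]
    simp
  simp only [hder, zero_mul, integral_zero, neg_zero, mul_neg, integral_neg, neg_eq_zero] at key
  rw [← key, ← integral_sub_left_eq_self _ volume x]
  refine integral_congr_ae (Eventually.of_forall fun t => ?_)
  simp [mul_comm]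

lemma convolution_fderiv_eq_zero {ψ f : Sp N → ℝ} (hψ : LocallyIntegrable ψ volume)
    (h : ∀ i, HasWeakPartial i ψ (fun _ => 0)) (hfs : ContDiff ℝ ∞ f) (hfc : HasCompactSupport f)
    (x : Sp N) :
    convolution (fderiv ℝ f) ψ ((ContinuousLinearMap.lsmul ℝ ℝ).precompL (Sp N)) volume x
      = (0 : Sp N →L[ℝ] ℝ) := by
  have hF : HasCompactSupport (fderiv ℝ f) := hfc.fderiv (𝕜 := ℝ)
  have hC : Continuous (fderiv ℝ f) := hfs.continuous_fderiv (by simp)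
  have hex := hF.convolutionExists_left ((ContinuousLinearMap.lsmul ℝ ℝ).precompL (Sp N)) hC hψ x
  unfold ConvolutionExistsAt at hex
  apply ContinuousLinearMap.coe_injective
  refine (EuclideanSpace.basisFun (Fin N) ℝ).toBasis.ext fun i => ?_
  rw [OrthonormalBasis.coe_toBasis, EuclideanSpace.basisFun_apply, convolution_def]
  refine (ContinuousLinearMap.integral_apply hex (EuclideanSpace.single i (1 : ℝ))).trans ?_
  simpa using integral_fderiv_mul_eq_zero (h i) hfs hfc x

/-- A locally integrable function on `ℝ^N` whose weak gradient vanishes is constant a.e. -/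
lemma ae_const_of_hasWeakPartial_zero {ψ : Sp N → ℝ} (hψ : LocallyIntegrable ψ volume)
    (h : ∀ i, HasWeakPartial i ψ (fun _ => 0)) : ∃ c : ℝ, ψ =ᵐ[volume] fun _ => c := by
  let b : ℕ → ContDiffBump (0 : Sp N) := fun n =>
    ⟨1 / (n + 1), 2 / (n + 1), by positivity, by gcongr; norm_num⟩
  let u : ℕ → Sp N → ℝ := fun n =>
    convolution ((b n).normed volume) ψ (ContinuousLinearMap.lsmul ℝ ℝ) volume
  have hconst : ∀ n x y, u n x = u n y := by
    intro n
    have hd : ∀ x, HasFDerivAt (u n) _ x := fun x =>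
      HasCompactSupport.hasFDerivAt_convolution_left (ContinuousLinearMap.lsmul ℝ ℝ)
        ((b n).hasCompactSupport_normed (μ := volume))
        ((b n).contDiff_normed (μ := volume) (n := 1)) hψ x
    have hzero : ∀ x, fderiv ℝ (u n) x = 0 := by
      intro x
      rw [(hd x).fderiv]
      exact convolution_fderiv_eq_zero hψ h ((b n).contDiff_normed (μ := volume) (n := ⊤))
        ((b n).hasCompactSupport_normed (μ := volume)) x
    exact fun x y => is_const_of_fderiv_eq_zero (fun x => (hd x).differentiableAt) hzero x y
  have hlim : ∀ᵐ x ∂(volume : Measure (Sp N)), Tendsto (fun n => u n x) atTop (𝓝 (ψ x)) := by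
    refine ContDiffBump.ae_convolution_tendsto_right_of_locallyIntegrable (K := 2) ?_ ?_ hψ
    · have := (tendsto_one_div_add_atTop_nhds_zero_nat (𝕜 := ℝ)).const_mul 2
      simpa [b, div_eq_mul_inv] using this
    · refine Eventually.of_forall fun n => ?_
      simp [b, div_eq_mul_inv]
  obtain ⟨x₀, hx₀⟩ := hlim.exists
  refine ⟨ψ x₀, ?_⟩
  filter_upwards [hlim] with x hx
  refine tendsto_nhds_unique hx ?_
  simpa only [hconst _ x x₀] using hx₀

/-! ### The Gauss-Sobolev space -/

/-- The measure `e^{-|x|²/2} dx` on `ℝ^N`. -/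
def gaussMeasure (N : ℕ) : Measure (Sp N) :=
  volume.withDensity fun x => ENNReal.ofReal (Real.exp (-‖x‖ ^ 2 / 2))

lemma gaussMeasure_ac : gaussMeasure N ≪ (volume : Measure (Sp N)) :=
  withDensity_absolutelyContinuous _ _

lemma ac_gaussMeasure : (volume : Measure (Sp N)) ≪ gaussMeasure N := by
  refine withDensity_absolutelyContinuous' (by fun_prop) ?_
  exact Eventually.of_forall fun x => by positivity

/-- Locally integrable functions `ψ` on `ℝ^N` with a weak gradient such that
`∫ |∇ψ|² e^{-|x|²/2} dx < ∞`. -/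
def preSpace (N : ℕ) : Submodule ℝ (Sp N → ℝ) where
  carrier := {ψ | LocallyIntegrable ψ volume ∧
    ∃ G : Sp N → Sp N, HasWeakGradient ψ G ∧ MemLp G 2 (gaussMeasure N)}
  zero_mem' := ⟨locallyIntegrable_zero, fun _ => 0, fun i => hasWeakPartial_const i 0,
    MemLp.zero'⟩
  add_mem' := by
    rintro ψ₁ ψ₂ ⟨h₁, G₁, w₁, m₁⟩ ⟨h₂, G₂, w₂, m₂⟩
    exact ⟨h₁.add h₂, fun x => G₁ x + G₂ x, fun i => (w₁ i).add (w₂ i), m₁.add m₂⟩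
  smul_mem' := by
    rintro c ψ ⟨h, G, w, m⟩
    exact ⟨h.smul c, fun x => c • G x, fun i => (w i).smul c, m.const_smul c⟩

/-- The functions that are a.e. equal to a constant. -/
def constSubmodule (N : ℕ) : Submodule ℝ (preSpace N) where
  carrier := {ψ | ∃ c : ℝ, (ψ : Sp N → ℝ) =ᵐ[volume] fun _ => c}
  zero_mem' := ⟨0, by rfl⟩
  add_mem' := by
    rintro ψ₁ ψ₂ ⟨c₁, h₁⟩ ⟨c₂, h₂⟩
    refine ⟨c₁ + c₂, ?_⟩
    filter_upwards [h₁, h₂] with x hx₁ hx₂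
    simp [hx₁, hx₂]
  smul_mem' := by
    rintro a ψ ⟨c, h⟩
    refine ⟨a * c, ?_⟩
    filter_upwards [h] with x hx
    simp [hx]

/-- The Gauss-Sobolev space: functions of `preSpace N` up to (a.e. equality and) additive
constants. -/
def GaussSobolev (N : ℕ) : Type := preSpace N ⧸ constSubmodule N

instance : AddCommGroup (GaussSobolev N) :=
  inferInstanceAs (AddCommGroup (preSpace N ⧸ constSubmodule N))

instance : Module ℝ (GaussSobolev N) :=
  inferInstanceAs (Module ℝ (preSpace N ⧸ constSubmodule N))

/-- The class of a function. -/
def toClass : preSpace N →ₗ[ℝ] GaussSobolev N := (constSubmodule N).mkQ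

lemma toClass_surjective : Function.Surjective (toClass (N := N)) :=
  (constSubmodule N).mkQ_surjective

lemma toClass_eq_zero_iff (ψ : preSpace N) :
    toClass ψ = 0 ↔ ∃ c : ℝ, (ψ : Sp N → ℝ) =ᵐ[volume] fun _ => c :=
  Submodule.Quotient.mk_eq_zero _

/-- The weak gradient of a function. -/
def weakGrad (ψ : preSpace N) : Sp N → Sp N := ψ.2.2.choose

lemma hasWeakGradient_weakGrad (ψ : preSpace N) : HasWeakGradient (ψ : Sp N → ℝ) (weakGrad ψ) :=
  ψ.2.2.choose_spec.1

lemma memLp_weakGrad (ψ : preSpace N) : MemLp (weakGrad ψ) 2 (gaussMeasure N) :=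
  ψ.2.2.choose_spec.2

lemma HasWeakGradient.unique {ψ₁ ψ₂ : Sp N → ℝ} {G₁ G₂ : Sp N → Sp N}
    (h₁ : HasWeakGradient ψ₁ G₁) (h₂ : HasWeakGradient ψ₂ G₂) (h : ψ₁ =ᵐ[volume] ψ₂) :
    G₁ =ᵐ[volume] G₂ := by
  have : ∀ᵐ x ∂(volume : Measure (Sp N)), ∀ i, G₁ x i = G₂ x i :=
    ae_all_iff.2 fun i => (h₁ i).unique (h₂ i) h
  filter_upwards [this] with x hx
  ext i
  exact hx i

/-- The gradient as an element of the Gauss space of vector fields. -/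
def gradAux : preSpace N →ₗ[ℝ] Lp (Sp N) 2 (gaussMeasure N) where
  toFun ψ := (memLp_weakGrad ψ).toLp (weakGrad ψ)
  map_add' ψ₁ ψ₂ := by
    rw [← MemLp.toLp_add]
    refine MemLp.toLp_congr _ _ (gaussMeasure_ac.ae_eq ?_)
    exact (hasWeakGradient_weakGrad (ψ₁ + ψ₂)).unique (G₂ := weakGrad ψ₁ + weakGrad ψ₂)
      (fun i => (hasWeakGradient_weakGrad ψ₁ i).add (hasWeakGradient_weakGrad ψ₂ i)) (by rfl)
  map_smul' c ψ := by
    rw [RingHom.id_apply, ← MemLp.toLp_const_smul]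
    refine MemLp.toLp_congr _ _ (gaussMeasure_ac.ae_eq ?_)
    exact (hasWeakGradient_weakGrad (c • ψ)).unique (G₂ := c • weakGrad ψ)
      (fun i => (hasWeakGradient_weakGrad ψ i).smul c) (by rfl)

lemma gradAux_eq_zero_iff (ψ : preSpace N) :
    gradAux ψ = 0 ↔ ∃ c : ℝ, (ψ : Sp N → ℝ) =ᵐ[volume] fun _ => c := by
  have e : gradAux ψ = 0 ↔ weakGrad ψ =ᵐ[volume] fun _ => 0 := by
    rw [Lp.eq_zero_iff_ae_eq_zero]
    constructor
    · intro h
      exact ac_gaussMeasure.ae_eq ((memLp_weakGrad ψ).coeFn_toLp.symm.trans h)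
    · intro h
      exact (memLp_weakGrad ψ).coeFn_toLp.trans (gaussMeasure_ac.ae_eq h)
  rw [e]
  constructor
  · intro h
    refine ae_const_of_hasWeakPartial_zero ψ.2.1 fun i => ?_
    have hw := hasWeakGradient_weakGrad ψ i
    refine ⟨hw.1, locallyIntegrable_const 0, fun φ hφ hc => ?_⟩
    rw [hw.3 φ hφ hc]
    congr 1
    apply integral_congr_ae
    filter_upwards [h] with x hx
    simp [hx]
  · rintro ⟨c, hc⟩
    exact (hasWeakGradient_weakGrad ψ).unique (G₂ := fun _ => 0)
      (fun i => hasWeakPartial_const i c) hc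

/-- The gradient of a class. -/
def grad : GaussSobolev N →ₗ[ℝ] Lp (Sp N) 2 (gaussMeasure N) :=
  (constSubmodule N).liftQ gradAux fun ψ hψ => (gradAux_eq_zero_iff ψ).2 hψ

lemma grad_toClass (ψ : preSpace N) :
    grad (toClass ψ) = (memLp_weakGrad ψ).toLp (weakGrad ψ) := rfl

lemma grad_injective : Function.Injective (grad (N := N)) := by
  rw [← LinearMap.ker_eq_bot, LinearMap.ker_eq_bot']
  intro u hu
  obtain ⟨ψ, rfl⟩ := toClass_surjective u
  exact (toClass_eq_zero_iff ψ).2 ((gradAux_eq_zero_iff ψ).1 hu)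

/-- The norm `‖ψ‖² = ∫ |∇ψ|² e^{-|x|²/2} dx`. -/
instance : NormedAddCommGroup (GaussSobolev N) :=
  NormedAddCommGroup.induced _ _ (grad (N := N)) grad_injective

/-- The inner product `⟪ψ, φ⟫ = ∫ ∇ψ · ∇φ e^{-|x|²/2} dx`. -/
instance : InnerProductSpace ℝ (GaussSobolev N) := InnerProductSpace.induced (grad (N := N))

lemma inner_toClass (ψ φ : preSpace N) :
    inner ℝ (toClass ψ) (toClass φ)
      = ∫ x, inner ℝ (weakGrad ψ x) (weakGrad φ x) ∂(gaussMeasure N) := by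
  change inner ℝ (grad (toClass ψ)) (grad (toClass φ)) = _
  rw [L2.inner_def, grad_toClass, grad_toClass]
  apply integral_congr_ae
  filter_upwards [(memLp_weakGrad ψ).coeFn_toLp, (memLp_weakGrad φ).coeFn_toLp] with x h₁ h₂
  rw [h₁, h₂]

/-- The class `u` is represented by the function `ψ`. -/
def Represents (u : GaussSobolev N) (ψ : Sp N → ℝ) : Prop :=
  ∃ h : ψ ∈ preSpace N, toClass ⟨ψ, h⟩ = u

/-! ### The Ornstein-Uhlenbeck operator -/

/-- `f = -Δψ + x·∇ψ` almost everywhere, with weak derivatives. -/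
def IsOrnsteinUhlenbeck (ψ f : Sp N → ℝ) : Prop :=
  ∃ g h : Fin N → Sp N → ℝ,
    (∀ i, HasWeakPartial i ψ (g i)) ∧ (∀ i, HasWeakPartial i (g i) (h i)) ∧
    f =ᵐ[volume] fun x => -(∑ i, h i x) + ∑ i, x i * g i x

lemma MemHloc.add {k : ℕ} : ∀ {ψ₁ ψ₂ : Sp N → ℝ}, MemHloc k ψ₁ → MemHloc k ψ₂ →
    MemHloc k (fun x => ψ₁ x + ψ₂ x) := by
  induction k with
  | zero => exact fun h₁ h₂ K hK => (h₁ K hK).add (h₂ K hK)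
  | succ k ih =>
    rintro ψ₁ ψ₂ ⟨l₁, h₁⟩ ⟨l₂, h₂⟩
    refine ⟨fun K hK => (l₁ K hK).add (l₂ K hK), fun i => ?_⟩
    obtain ⟨g₁, w₁, m₁⟩ := h₁ i
    obtain ⟨g₂, w₂, m₂⟩ := h₂ i
    exact ⟨_, w₁.add w₂, ih m₁ m₂⟩

lemma MemHloc.smul {k : ℕ} (c : ℝ) : ∀ {ψ : Sp N → ℝ}, MemHloc k ψ →
    MemHloc k (fun x => c * ψ x) := by
  induction k with
  | zero => exact fun h K hK => (h K hK).const_mul c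
  | succ k ih =>
    rintro ψ ⟨l, h⟩
    refine ⟨fun K hK => (l K hK).const_mul c, fun i => ?_⟩
    obtain ⟨g, w, m⟩ := h i
    exact ⟨_, w.smul c, ih m⟩

lemma memHloc_zero (k : ℕ) : MemHloc k (fun _ : Sp N => (0 : ℝ)) := by
  induction k with
  | zero => exact fun K _ => MemLp.zero'
  | succ k ih => exact ⟨fun K _ => MemLp.zero', fun i => ⟨_, hasWeakPartial_const i 0, ih⟩⟩

lemma IsOrnsteinUhlenbeck.add {ψ₁ ψ₂ f₁ f₂ : Sp N → ℝ} (h₁ : IsOrnsteinUhlenbeck ψ₁ f₁)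
    (h₂ : IsOrnsteinUhlenbeck ψ₂ f₂) :
    IsOrnsteinUhlenbeck (fun x => ψ₁ x + ψ₂ x) (fun x => f₁ x + f₂ x) := by
  obtain ⟨g₁, k₁, a₁, b₁, c₁⟩ := h₁
  obtain ⟨g₂, k₂, a₂, b₂, c₂⟩ := h₂
  refine ⟨fun i x => g₁ i x + g₂ i x, fun i x => k₁ i x + k₂ i x, fun i => (a₁ i).add (a₂ i),
    fun i => (b₁ i).add (b₂ i), ?_⟩
  filter_upwards [c₁, c₂] with x h₁ h₂
  simp only [h₁, h₂, mul_add, Finset.sum_add_distrib]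
  ring

lemma IsOrnsteinUhlenbeck.smul (c : ℝ) {ψ f : Sp N → ℝ} (h : IsOrnsteinUhlenbeck ψ f) :
    IsOrnsteinUhlenbeck (fun x => c * ψ x) (fun x => c * f x) := by
  obtain ⟨g, k, a₁, a₂, a₃⟩ := h
  refine ⟨fun i x => c * g i x, fun i x => c * k i x, fun i => (a₁ i).smul c,
    fun i => (a₂ i).smul c, ?_⟩
  filter_upwards [a₃] with x h
  simp only [h, mul_left_comm _ c, ← Finset.mul_sum]
  ring

lemma isOrnsteinUhlenbeck_const (c : ℝ) :
    IsOrnsteinUhlenbeck (fun _ : Sp N => c) (fun _ => 0) :=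
  ⟨fun _ _ => 0, fun _ _ => 0, fun i => hasWeakPartial_const i c,
    fun i => hasWeakPartial_const i 0, by simp⟩

lemma IsOrnsteinUhlenbeck.unique {ψ₁ ψ₂ f₁ f₂ : Sp N → ℝ} (h₁ : IsOrnsteinUhlenbeck ψ₁ f₁)
    (h₂ : IsOrnsteinUhlenbeck ψ₂ f₂) (h : ψ₁ =ᵐ[volume] ψ₂) : f₁ =ᵐ[volume] f₂ := by
  obtain ⟨g₁, k₁, a₁, b₁, c₁⟩ := h₁
  obtain ⟨g₂, k₂, a₂, b₂, c₂⟩ := h₂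
  have hg := fun i => (a₁ i).unique (a₂ i) h
  have hk := fun i => (b₁ i).unique (b₂ i) (hg i)
  filter_upwards [c₁, c₂, ae_all_iff.2 hg, ae_all_iff.2 hk] with x e₁ e₂ e₃ e₄
  simp only [e₁, e₂, e₃, e₄]

/-- The graph of the Ornstein-Uhlenbeck operator with domain
`{ψ ∈ H³_loc : ψ and -Δψ + x·∇ψ are in the Gauss-Sobolev space}`. -/
def ouGraph (N : ℕ) : Submodule ℝ (GaussSobolev N × GaussSobolev N) where
  carrier := {p | ∃ ψ f : preSpace N, MemHloc 3 (ψ : Sp N → ℝ) ∧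
    IsOrnsteinUhlenbeck (ψ : Sp N → ℝ) f ∧ toClass ψ = p.1 ∧ toClass f = p.2}
  zero_mem' := ⟨0, 0, memHloc_zero 3, isOrnsteinUhlenbeck_const 0, by simp, by simp⟩
  add_mem' := by
    rintro p q ⟨ψ₁, f₁, m₁, o₁, a₁, b₁⟩ ⟨ψ₂, f₂, m₂, o₂, a₂, b₂⟩
    exact ⟨ψ₁ + ψ₂, f₁ + f₂, m₁.add m₂, o₁.add o₂, by simp [a₁, a₂], by simp [b₁, b₂]⟩
  smul_mem' := by
    rintro c p ⟨ψ, f, m, o, a, b⟩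
    exact ⟨c • ψ, c • f, m.smul c, o.smul c, by simp [a], by simp [b]⟩

/-- The Ornstein-Uhlenbeck operator `ψ ↦ -Δψ + x·∇ψ` in the Gauss-Sobolev space. -/
def ouOperator (N : ℕ) : GaussSobolev N →ₗ.[ℝ] GaussSobolev N := (ouGraph N).toLinearPMap

lemma ouGraph_singleValued (p : GaussSobolev N × GaussSobolev N) (hp : p ∈ ouGraph N)
    (h : p.1 = 0) : p.2 = 0 := by
  obtain ⟨ψ, f, -, o, a, b⟩ := hp
  rw [← a] at h
  obtain ⟨c, hc⟩ := (toClass_eq_zero_iff ψ).1 h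
  rw [← b]
  exact (toClass_eq_zero_iff f).2 ⟨0, o.unique (isOrnsteinUhlenbeck_const c) hc⟩

lemma ouOperator_graph : (ouOperator N).graph = ouGraph N :=
  (ouGraph N).toLinearPMap_graph_eq fun p hp h => ouGraph_singleValued p hp h

/-! ### Hermite polynomials -/

/-- The Hermite polynomial `x ↦ ∏ᵢ ψ_{αᵢ}(xᵢ)` on `ℝ^N`, where `ψ_n` is the `n`-th one-dimensional
(probabilists') Hermite polynomial: `ψ_0 = 1`, `ψ_{n+1}(z) = z ψ_n(z) - ψ_n'(z)`. -/
def hermiteFun (α : Fin N → ℕ) (x : Sp N) : ℝ :=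
  ∏ i, Polynomial.aeval (x i) (Polynomial.hermite (α i))

end GaussSob

end

/-! Write `γ` for `gaussMeasure N`, `w` for its density, `H_α` for `hermiteFun α`, `c_α(u) = ∫ u H_α
dγ`, `n_α = c_α(H_α)`, and `e_i` for `Pi.single i 1`. Everything rests on the identities `∂_i H_α =
α_i H_{α-e_i}` and `∂_i (H_α w) = -H_{α+e_i} w`. By the second, integration by parts becomes an
index shift, `c_β(∂_i u) = c_{β+e_i}(u)`, and `f = -Δψ + x·∇ψ` becomes `c_α(f) = |α| c_α(ψ)`.

The `H_α` are orthogonal and complete in `L²(γ)`. In the gradient inner product the pairing of `H_α`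
with `ψ` is `|α| c_α(ψ)`, so the classes of the `H_α` with `α ≠ 0`, divided by `√(|α| n_α)`, form a
Hilbert basis (`sobolevBasis`). In it the operator is diagonal with entries `|α|`, and its domain is
as large as possible (`isDiagonal_ouOperator`). Self-adjointness, spectrum and eigenspaces then
follow from general facts about diagonal operators.

Three points need work. A function of the space is a priori only locally integrable; that it lies in
`L²(γ)` is seen by rebuilding a potential from the coefficients of its curl-free gradient
(`exists_potential`, `memLp_preSpace`). The same construction identifies the range of the gradient
as a closed subspace, hence completeness of the space. Finally, the maximal diagonal domain consists
of `H³_loc` functions: a finite gradient norm of `f` says that `∑ |α|³ c_α(ψ)² / n_α` converges, and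
each power of `|α|` buys one weak derivative (`memGaussH_of_hermiteCoeff`,
`MemGaussH.exists_hasWeakPartial`). -/

noncomputable section

namespace GaussSob

/-! ### Diagonal operators -/

section Diagonal

variable {V ι : Type*} [NormedAddCommGroup V] [InnerProductSpace ℝ V]

/-- `T` is the maximal operator that is diagonal in the Hilbert basis `b` with entries `l`. -/
def IsDiagonal (T : V →ₗ.[ℝ] V) (b : HilbertBasis ι ℝ V) (l : ι → ℝ) : Prop :=
  ∀ x y : V, (x, y) ∈ T.graph ↔ ∀ i, inner ℝ (b i) y = l i * inner ℝ (b i) x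

lemma hilbertBasis_ext (b : HilbertBasis ι ℝ V) {x y : V}
    (h : ∀ i, inner ℝ (b i) x = inner ℝ (b i) y) : x = y := by
  apply b.repr.injective
  ext i
  rw [b.repr_apply_apply, b.repr_apply_apply, h i]

variable {T : V →ₗ.[ℝ] V} {b : HilbertBasis ι ℝ V} {l : ι → ℝ}

lemma IsDiagonal.basis_mem_graph (h : IsDiagonal T b l) (i : ι) : (b i, l i • b i) ∈ T.graph := by
  classical
  rw [h]
  intro j
  rw [inner_smul_right]
  have := b.orthonormal
  rw [orthonormal_iff_ite] at this
  rw [this j i]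
  split_ifs with hji
  · rw [hji]
  · simp

lemma IsDiagonal.dense_domain (h : IsDiagonal T b l) : Dense (T.domain : Set V) := by
  have hle : Submodule.span ℝ (Set.range b) ≤ T.domain := by
    rw [Submodule.span_le]
    rintro _ ⟨i, rfl⟩
    exact LinearPMap.mem_domain_of_mem_graph (h.basis_mem_graph i)
  have hd : Dense ((Submodule.span ℝ (Set.range b) : Submodule ℝ V) : Set V) := by
    rw [Submodule.dense_iff_topologicalClosure_eq_top]
    exact b.dense_span
  exact hd.mono hle

/-- Pairing a point of the adjoint graph with the basis vectors yields exactly the coefficient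
equations that define the graph of `T`. Conversely, these equations make the two Parseval series
agree term by term. -/
lemma IsDiagonal.isSelfAdjoint [CompleteSpace V] (h : IsDiagonal T b l) : IsSelfAdjoint T := by
  rw [LinearPMap.isSelfAdjoint_def]
  apply LinearPMap.eq_of_eq_graph
  rw [LinearPMap.adjoint_graph_eq_graph_adjoint h.dense_domain]
  ext ⟨y, z⟩
  rw [Submodule.mem_adjoint_iff]
  constructor
  · intro hyz
    rw [h]
    intro i
    have := hyz _ _ (h.basis_mem_graph i)
    rw [real_inner_smul_left] at this
    simp only at this
    linarith
  · intro hyz x w hxw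
    rw [h] at hyz hxw
    simp only
    rw [← (b.hasSum_inner_mul_inner w y).tsum_eq, ← (b.hasSum_inner_mul_inner x z).tsum_eq,
      sub_eq_zero]
    refine tsum_congr fun i => ?_
    rw [hyz i, real_inner_comm, hxw i, real_inner_comm (b i) x]
    ring

lemma IsDiagonal.mem_eigenspace_iff (h : IsDiagonal T b l) (z : ℝ) (u : V) :
    u ∈ eigenspace T z ↔ ∀ i, l i ≠ z → inner ℝ (b i) u = 0 := by
  have e : u ∈ eigenspace T z ↔ (u, z • u) ∈ T.graph := by
    rw [LinearPMap.mem_graph_iff]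
    constructor
    · rintro ⟨hu, hu'⟩
      exact ⟨⟨u, hu⟩, rfl, hu'⟩
    · rintro ⟨⟨v, hv⟩, hvu, hv'⟩
      obtain rfl : v = u := hvu
      exact ⟨hv, hv'⟩
  rw [e, h]
  refine forall_congr' fun i => ?_
  rw [inner_smul_right]
  constructor
  · intro h1 h2
    have : (l i - z) * inner ℝ (b i) u = 0 := by linarith
    exact (mul_eq_zero.1 this).resolve_left (sub_ne_zero.2 h2)
  · intro h1
    by_cases h2 : l i = z
    · rw [h2]
    · rw [h1 h2]
      simp

/-- An eigenvector has coefficients only where `l i = z`. Finiteness of that index set turns its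
expansion into a finite sum, so the algebraic span needs no closure. -/
lemma IsDiagonal.eigenspace_eq_span (h : IsDiagonal T b l) (z : ℝ) (hf : {i | l i = z}.Finite) :
    eigenspace T z = Submodule.span ℝ (b '' {i | l i = z}) := by
  apply le_antisymm
  · intro u hu
    rw [h.mem_eigenspace_iff] at hu
    have hs := b.hasSum_repr u
    have hz : ∀ i ∉ hf.toFinset, b.repr u i • b i = 0 := by
      intro i hi
      rw [b.repr_apply_apply, hu i (by simpa using hi), zero_smul]
    rw [← hs.tsum_eq, tsum_eq_sum hz]
    refine Submodule.sum_mem _ fun i hi => Submodule.smul_mem _ _ (Submodule.subset_span ?_)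
    exact ⟨i, by simpa using hi, rfl⟩
  · rw [Submodule.span_le]
    rintro _ ⟨i, hi, rfl⟩
    rw [SetLike.mem_coe, h.mem_eigenspace_iff]
    intro j hj
    refine b.orthonormal.2 ?_
    rintro rfl
    exact hj hi

/-- The bounded diagonal operator with entries `c`. -/
lemma exists_diagonal_clm (b : HilbertBasis ι ℝ V) (c : ι → ℝ) (C : ℝ) (hC : ∀ i, |c i| ≤ C) :
    ∃ R : V →L[ℝ] V, ∀ y i, inner ℝ (b i) (R y) = c i * inner ℝ (b i) y := by
  have hsum : ∀ y : V, Summable fun i => ‖b.repr y i‖ ^ 2 := fun y => by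
    simpa using (lp.memℓp (b.repr y)).summable (by norm_num)
  -- The bound is `|C|` and not `C`, since for an empty index set `hC` does not force `C` to be
  -- nonnegative.
  have hle : ∀ (y : V) i, ‖c i * b.repr y i‖ ^ 2 ≤ |C| ^ 2 * ‖b.repr y i‖ ^ 2 := by
    intro y i
    rw [norm_mul, mul_pow]
    gcongr
    exact (hC i).trans (le_abs_self C)
  have hmem : ∀ y : V, Memℓp (fun i => c i * b.repr y i) 2 := by
    intro y
    refine memℓp_gen ?_
    have : Summable fun i => ‖c i * b.repr y i‖ ^ 2 :=
      Summable.of_nonneg_of_le (fun i => by positivity) (hle y) ((hsum y).mul_left _)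
    simpa using this
  let R₀ : V →ₗ[ℝ] V :=
    { toFun := fun y => b.repr.symm ⟨fun i => c i * b.repr y i, hmem y⟩
      map_add' := fun x y => by
        rw [← map_add]
        congr 1
        ext i
        simp only [map_add, lp.coeFn_add, Pi.add_apply, mul_add]
      map_smul' := fun a y => by
        rw [RingHom.id_apply, ← map_smul]
        congr 1
        ext i
        simp [mul_left_comm] }
  have hnorm : ∀ y, ‖R₀ y‖ ≤ |C| * ‖y‖ := by
    intro y
    have e1 : ‖R₀ y‖ = ‖(⟨fun i => c i * b.repr y i, hmem y⟩ : lp (fun _ : ι => ℝ) 2)‖ :=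
      b.repr.symm.norm_map _
    have e2 : ‖y‖ = ‖b.repr y‖ := (b.repr.norm_map y).symm
    rw [e1]
    refine lp.norm_le_of_forall_sum_le (by norm_num) (by positivity) fun s => ?_
    have e3 := lp.sum_rpow_le_norm_rpow (p := 2) (by norm_num) (b.repr y) s
    simp only [ENNReal.toReal_ofNat, Real.rpow_ofNat] at e3 ⊢
    rw [mul_pow, e2]
    calc ∑ i ∈ s, ‖c i * b.repr y i‖ ^ 2 ≤ ∑ i ∈ s, |C| ^ 2 * ‖b.repr y i‖ ^ 2 :=
          Finset.sum_le_sum fun i _ => hle y i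
      _ = |C| ^ 2 * ∑ i ∈ s, ‖b.repr y i‖ ^ 2 := by rw [Finset.mul_sum]
      _ ≤ _ := by gcongr
  refine ⟨R₀.mkContinuous _ hnorm, fun y i => ?_⟩
  rw [← b.repr_apply_apply, ← b.repr_apply_apply]
  change b.repr (b.repr.symm _) i = _
  rw [LinearIsometryEquiv.apply_symm_apply]

/-- The inverse is the diagonal operator with entries `(l i - z)⁻¹`, bounded by `ε⁻¹`. Its range
lies in the domain because the graph contains every pair that satisfies the coefficient equations.
-/
lemma IsDiagonal.isResolventPoint (h : IsDiagonal T b l) {z ε : ℝ} (hε : 0 < ε)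
    (hz : ∀ i, ε ≤ |l i - z|) : IsResolventPoint T z := by
  have hne : ∀ i, l i - z ≠ 0 := fun i => abs_pos.1 (hε.trans_le (hz i))
  obtain ⟨R, hR⟩ := exists_diagonal_clm b (fun i => (l i - z)⁻¹) ε⁻¹ fun i => by
    rw [abs_inv]
    exact inv_anti₀ hε (hz i)
  refine ⟨R, fun y => ?_, fun x => ?_⟩
  · have hg : (R y, y + z • R y) ∈ T.graph := by
      rw [h]
      intro i
      rw [inner_add_right, inner_smul_right, hR]
      field_simp [hne i]
      ring
    rw [LinearPMap.mem_graph_iff] at hg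
    obtain ⟨⟨v, hv⟩, hvR, hv'⟩ := hg
    obtain rfl : v = R y := hvR
    refine ⟨hv, ?_⟩
    rw [hv']
    simp
  · refine hilbertBasis_ext b fun i => ?_
    have := (h _ _).1 (T.mem_graph x) i
    rw [hR, inner_sub_right, inner_smul_right, this]
    field_simp [hne i]

/-- A resolvent would have to send `T b_i - l_i b_i = 0` back to the unit vector `b_i`. -/
lemma IsDiagonal.mem_unboundedSpectrum (h : IsDiagonal T b l) (i : ι) :
    l i ∈ unboundedSpectrum T := by
  rintro ⟨R, -, hR⟩
  have hg := h.basis_mem_graph i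
  rw [LinearPMap.mem_graph_iff] at hg
  obtain ⟨x, hx, hx'⟩ := hg
  have := hR x
  rw [hx', hx] at this
  simp only [sub_self, map_zero] at this
  have h1 := b.orthonormal.1 i
  rw [← this, norm_zero] at h1
  exact zero_ne_one h1

/-- Points off a set of naturals have positive distance to it. -/
lemma exists_pos_le_abs_natCast_sub (z : ℝ) :
    ∃ ε > 0, ∀ n : ℕ, (n : ℝ) ≠ z → ε ≤ |(n : ℝ) - z| := by
  have hc : IsClosed ((fun n : ℕ => (n : ℝ)) '' {n : ℕ | (n : ℝ) ≠ z}) :=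
    Nat.isClosedEmbedding_coe_real.isClosedMap _ (isClosed_discrete _)
  have hz : z ∉ (fun n : ℕ => (n : ℝ)) '' {n : ℕ | (n : ℝ) ≠ z} := by
    rintro ⟨n, hn, rfl⟩
    exact hn rfl
  obtain ⟨ε, hε, hb⟩ := Metric.isOpen_iff.1 hc.isOpen_compl z hz
  refine ⟨ε, hε, fun n hn => ?_⟩
  by_contra! hlt
  exact hb (by rwa [Metric.mem_ball, Real.dist_eq]) ⟨n, hn, rfl⟩

variable {m : ι → ℕ}

/-- Natural entries keep a positive distance from every other real number, so the spectrum is their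
range itself and not merely its closure. -/
lemma IsDiagonal.unboundedSpectrum_eq (h : IsDiagonal T b fun i => (m i : ℝ)) :
    unboundedSpectrum T = Set.range fun i => (m i : ℝ) := by
  apply Set.Subset.antisymm
  · intro z hz
    by_contra hne
    obtain ⟨ε, hε, hd⟩ := exists_pos_le_abs_natCast_sub z
    exact hz (h.isResolventPoint hε fun i => hd _ fun e => hne ⟨i, e⟩)
  · rintro _ ⟨i, rfl⟩
    exact h.mem_unboundedSpectrum i

lemma IsDiagonal.hasPurelyDiscreteSpectrum (h : IsDiagonal T b fun i => (m i : ℝ))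
    (hf : ∀ n, {i | m i = n}.Finite) : HasPurelyDiscreteSpectrum T := by
  rw [HasPurelyDiscreteSpectrum, h.unboundedSpectrum_eq]
  constructor
  · rintro _ ⟨i, rfl⟩
    have hfin : {j | (m j : ℝ) = (m i : ℝ)}.Finite := by
      simpa only [Nat.cast_inj] using hf (m i)
    beta_reduce
    rw [h.eigenspace_eq_span _ hfin]
    constructor
    · intro hbot
      have : b i ∈ (⊥ : Submodule ℝ V) := hbot ▸ Submodule.subset_span ⟨i, rfl, rfl⟩
      exact b.orthonormal.ne_zero i ((Submodule.mem_bot ℝ).1 this)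
    · exact FiniteDimensional.span_of_finite ℝ (hfin.image b)
  · intro z hz
    obtain ⟨ε, hε, hd⟩ := exists_pos_le_abs_natCast_sub z
    rw [accPt_iff_nhds] at hz
    obtain ⟨y, ⟨hy, i, rfl⟩, hne⟩ := hz _ (Metric.ball_mem_nhds z hε)
    rw [Metric.mem_ball, Real.dist_eq] at hy
    exact absurd (hd _ hne) (not_le.2 hy)

end Diagonal

/-! ### Integration against the Gauss measure -/

section Gauss

variable {N : ℕ}

/-- The Gauss weight. -/
def gaussWeight (x : Sp N) : ℝ := Real.exp (-‖x‖ ^ 2 / 2)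

lemma contDiff_gaussWeight : ContDiff ℝ ∞ (gaussWeight (N := N)) :=
  (((contDiff_norm_sq ℝ (E := Sp N) (n := ∞)).neg).div_const 2).exp

lemma continuous_gaussWeight : Continuous (gaussWeight (N := N)) := contDiff_gaussWeight.continuous

lemma gaussWeight_pos (x : Sp N) : 0 < gaussWeight x := Real.exp_pos _

lemma fderiv_gaussWeight (x : Sp N) (i : Fin N) :
    fderiv ℝ gaussWeight x (EuclideanSpace.single i 1) = -(x i * gaussWeight x) := by
  have h1 : HasFDerivAt (fun x : Sp N => ‖x‖ ^ 2) ((2 : ℕ) • innerSL ℝ x) x :=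
    (hasStrictFDerivAt_norm_sq x).hasFDerivAt
  have h2 : HasFDerivAt (fun x : Sp N => -‖x‖ ^ 2 / 2) ((2⁻¹ : ℝ) • -((2 : ℕ) • innerSL ℝ x)) x := by
    simpa only [div_eq_mul_inv] using! h1.neg.mul_const (2⁻¹ : ℝ)
  have h3 : fderiv ℝ (gaussWeight (N := N)) x = _ := h2.exp.fderiv
  rw [h3]
  simp [gaussWeight, EuclideanSpace.inner_single_right, div_eq_mul_inv]
  ring

lemma integral_gaussMeasure (f : Sp N → ℝ) :
    ∫ x, f x ∂gaussMeasure N = ∫ x, f x * gaussWeight x := by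
  rw [gaussMeasure, integral_withDensity_eq_integral_toReal_smul (by fun_prop)
    (Eventually.of_forall fun x => ENNReal.ofReal_lt_top)]
  refine integral_congr_ae (Eventually.of_forall fun x => ?_)
  simp only [ENNReal.toReal_ofReal (Real.exp_pos _).le, smul_eq_mul, gaussWeight]
  ring

lemma integrable_gaussMeasure_iff {f : Sp N → ℝ} :
    Integrable f (gaussMeasure N) ↔ Integrable fun x => f x * gaussWeight x := by
  rw [gaussMeasure, integrable_withDensity_iff (by fun_prop)
    (Eventually.of_forall fun x => ENNReal.ofReal_lt_top)]
  simp only [ENNReal.toReal_ofReal (Real.exp_pos _).le, gaussWeight]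

/-- Half of the Gaussian decay absorbs the exponential: `(a - ‖x‖/2)² ≥ 0` gives `a‖x‖ - ‖x‖²/2 ≤ a²
- ‖x‖²/4`. -/
lemma integrable_exp_mul_norm (a : ℝ) :
    Integrable (fun x : Sp N => Real.exp (a * ‖x‖)) (gaussMeasure N) := by
  rw [integrable_gaussMeasure_iff]
  have h0 : Integrable fun x : Sp N => Real.exp (-(1 / 4) * ‖x‖ ^ 2) := by
    have := (GaussianFourier.integrable_cexp_neg_mul_sq_norm_add (V := Sp N) (b := 1 / 4)
      (by norm_num) 0 0).norm
    refine this.congr (Eventually.of_forall fun x => ?_)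
    simp only [Complex.norm_exp]
    congr 1
    simp [← Complex.ofReal_pow]
  refine (h0.const_mul (Real.exp (a ^ 2))).mono' ?_ (Eventually.of_forall fun x => ?_)
  · exact ((by fun_prop : Continuous fun x : Sp N => Real.exp (a * ‖x‖)).mul
      continuous_gaussWeight).aestronglyMeasurable
  · rw [Real.norm_of_nonneg (mul_nonneg (Real.exp_pos _).le (gaussWeight_pos x).le), gaussWeight,
      ← Real.exp_add, ← Real.exp_add]
    apply Real.exp_le_exp.2
    nlinarith [sq_nonneg (a - ‖x‖ / 2)]

instance : IsFiniteMeasure (gaussMeasure N) := by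
  have := integrable_exp_mul_norm (N := N) 0
  simp only [zero_mul, Real.exp_zero] at this
  exact (integrable_const_iff_isFiniteMeasure one_ne_zero).1 this

/-- Continuous functions of at most exponential growth. -/
structure ExpBounded (p : Sp N → ℝ) : Prop where
  continuous : Continuous p
  bound : ∃ C a : ℝ, ∀ x, |p x| ≤ C * Real.exp (a * ‖x‖)

/-- Functions that are integrable with respect to all exponentially weighted Gauss measures. -/
def ExpIntegrable (F : Sp N → ℝ) : Prop :=
  ∀ a : ℝ, Integrable (fun x => F x * Real.exp (a * ‖x‖)) (gaussMeasure N)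

lemma ExpBounded.const (c : ℝ) : ExpBounded fun _ : Sp N => c :=
  ⟨continuous_const, |c|, 0, fun x => by simp⟩

lemma ExpBounded.coord (i : Fin N) : ExpBounded fun x : Sp N => x i := by
  refine ⟨by fun_prop, 1, 1, fun x => ?_⟩
  have h1 : |x i| ≤ ‖x‖ := PiLp.norm_apply_le x i
  have h2 := Real.add_one_le_exp ‖x‖
  rw [one_mul, one_mul]
  linarith

lemma ExpBounded.mul {p q : Sp N → ℝ} (hp : ExpBounded p) (hq : ExpBounded q) :
    ExpBounded fun x => p x * q x := by
  obtain ⟨cp, C, a, hC⟩ := hp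
  obtain ⟨cq, D, b, hD⟩ := hq
  refine ⟨cp.mul cq, C * D, a + b, fun x => ?_⟩
  rw [abs_mul, add_mul, Real.exp_add]
  calc |p x| * |q x| ≤ (C * Real.exp (a * ‖x‖)) * (D * Real.exp (b * ‖x‖)) :=
        mul_le_mul (hC x) (hD x) (abs_nonneg _) ((abs_nonneg _).trans (hC x))
    _ = _ := by ring

lemma ExpBounded.add {p q : Sp N → ℝ} (hp : ExpBounded p) (hq : ExpBounded q) :
    ExpBounded fun x => p x + q x := by
  obtain ⟨cp, C, a, hC⟩ := hp
  obtain ⟨cq, D, b, hD⟩ := hq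
  refine ⟨cp.add cq, |C| + |D|, max a b, fun x => (abs_add_le _ _).trans ?_⟩
  rw [add_mul]
  refine add_le_add ((hC x).trans ?_) ((hD x).trans ?_)
  · exact mul_le_mul (le_abs_self C) (Real.exp_le_exp.2 (by gcongr; exact le_max_left _ _))
      (Real.exp_pos _).le (abs_nonneg _)
  · exact mul_le_mul (le_abs_self D) (Real.exp_le_exp.2 (by gcongr; exact le_max_right _ _))
      (Real.exp_pos _).le (abs_nonneg _)

lemma ExpIntegrable.aestronglyMeasurable {F : Sp N → ℝ} (hF : ExpIntegrable F) :
    AEStronglyMeasurable F (gaussMeasure N) := by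
  simpa using (hF 0).aestronglyMeasurable

/-- The quantifier over all exponents absorbs the growth of `p`. This stability under polynomial
factors, which `L²(γ)` lacks, makes the class suitable for terms such as `x i * g i x`. -/
lemma ExpIntegrable.mul {F p : Sp N → ℝ} (hF : ExpIntegrable F) (hp : ExpBounded p) :
    ExpIntegrable fun x => F x * p x := by
  obtain ⟨cp, C, b, hC⟩ := hp
  intro a
  refine ((hF (a + b)).norm.const_mul C).mono'
    ((hF.aestronglyMeasurable.mul cp.aestronglyMeasurable).mul
      (by fun_prop : Continuous fun x : Sp N => Real.exp (a * ‖x‖)).aestronglyMeasurable)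
    (Eventually.of_forall fun x => ?_)
  rw [norm_mul, norm_mul, norm_mul, Real.norm_eq_abs (p x), Real.norm_of_nonneg (Real.exp_pos _).le,
    Real.norm_of_nonneg (Real.exp_pos _).le, add_mul, Real.exp_add]
  calc ‖F x‖ * |p x| * Real.exp (a * ‖x‖)
      ≤ ‖F x‖ * (C * Real.exp (b * ‖x‖)) * Real.exp (a * ‖x‖) := by gcongr; exact hC x
    _ = _ := by ring

lemma ExpIntegrable.integrable {F : Sp N → ℝ} (hF : ExpIntegrable F) :
    Integrable F (gaussMeasure N) := by
  simpa using hF 0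

lemma ExpIntegrable.integrable_mul_weight {F p : Sp N → ℝ} (hF : ExpIntegrable F)
    (hp : ExpBounded p) : Integrable fun x => F x * (p x * gaussWeight x) := by
  simpa only [mul_assoc] using integrable_gaussMeasure_iff.1 (hF.mul hp).integrable

lemma ExpIntegrable.add {F G : Sp N → ℝ} (hF : ExpIntegrable F) (hG : ExpIntegrable G) :
    ExpIntegrable fun x => F x + G x := fun a => by
  simpa only [add_mul] using! (hF a).add (hG a)

lemma ExpIntegrable.neg {F : Sp N → ℝ} (hF : ExpIntegrable F) :
    ExpIntegrable fun x => -F x := fun a => by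
  simpa only [neg_mul] using! (hF a).neg

lemma ExpIntegrable.congr {F G : Sp N → ℝ} (hF : ExpIntegrable F)
    (h : F =ᵐ[gaussMeasure N] G) : ExpIntegrable G := fun a => by
  refine (hF a).congr ?_
  filter_upwards [h] with x hx
  rw [hx]

lemma ExpIntegrable.sum {ι : Type*} (s : Finset ι) {F : ι → Sp N → ℝ}
    (hF : ∀ i ∈ s, ExpIntegrable (F i)) : ExpIntegrable fun x => ∑ i ∈ s, F i x := fun a => by
  simpa only [Finset.sum_mul] using integrable_finsetSum s fun i hi => hF i hi a

lemma ExpBounded.expIntegrable {p : Sp N → ℝ} (hp : ExpBounded p) : ExpIntegrable p := by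
  have h1 : ExpIntegrable fun _ : Sp N => 1 := fun a => by
    simpa using integrable_exp_mul_norm a
  simpa using h1.mul hp

lemma ExpBounded.memLp {p : Sp N → ℝ} (hp : ExpBounded p) : MemLp p 2 (gaussMeasure N) := by
  rw [memLp_two_iff_integrable_sq hp.continuous.aestronglyMeasurable]
  simpa only [sq] using (hp.mul hp).expIntegrable.integrable

lemma expBounded_exp (a : ℝ) : ExpBounded fun x : Sp N => Real.exp (a * ‖x‖) :=
  ⟨by fun_prop, 1, a, fun x => by simp⟩

lemma _root_.MeasureTheory.MemLp.expIntegrable {u : Sp N → ℝ} (hu : MemLp u 2 (gaussMeasure N)) :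
    ExpIntegrable u := fun a => hu.integrable_mul (expBounded_exp a).memLp

lemma _root_.HasCompactSupport.expBounded {p : Sp N → ℝ} (hp : Continuous p)
    (hc : HasCompactSupport p) : ExpBounded p := by
  obtain ⟨C, hC⟩ := hc.exists_bound_of_continuous hp
  exact ⟨hp, C, 0, fun x => by simpa using hC x⟩

/-- The reciprocal of the weight is continuous, hence bounded on compact sets. -/
lemma memLp_restrict_of_gaussMeasure {u : Sp N → ℝ} (hu : MemLp u 2 (gaussMeasure N))
    {K : Set (Sp N)} (hK : IsCompact K) : MemLp u 2 (volume.restrict K) := by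
  have hm : AEStronglyMeasurable u volume := hu.aestronglyMeasurable.mono_ac ac_gaussMeasure
  rw [memLp_two_iff_integrable_sq hu.aestronglyMeasurable, integrable_gaussMeasure_iff] at hu
  rw [memLp_two_iff_integrable_sq hm.restrict]
  have hc : ContinuousOn (fun x : Sp N => (gaussWeight x)⁻¹) K :=
    (continuous_gaussWeight.inv₀ fun x => (gaussWeight_pos x).ne').continuousOn
  have := hu.integrableOn (s := K) |>.mul_continuousOn hc hK
  refine Integrable.congr this (Eventually.of_forall fun x => ?_)
  simp only
  rw [mul_assoc, mul_inv_cancel₀ (gaussWeight_pos x).ne', mul_one]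

lemma ExpIntegrable.locallyIntegrable {u : Sp N → ℝ} (hu : ExpIntegrable u) :
    LocallyIntegrable u volume := by
  rw [locallyIntegrable_iff]
  intro K hK
  have hc : ContinuousOn (fun x : Sp N => (gaussWeight x)⁻¹) K :=
    (continuous_gaussWeight.inv₀ fun x => (gaussWeight_pos x).ne').continuousOn
  have := (integrable_gaussMeasure_iff.1 hu.integrable).integrableOn (s := K)
    |>.mul_continuousOn hc hK
  refine Integrable.congr this (Eventually.of_forall fun x => ?_)
  simp only
  rw [mul_assoc, mul_inv_cancel₀ (gaussWeight_pos x).ne', mul_one]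

end Gauss

/-! ### Hermite polynomials -/

section Hermite

variable {N : ℕ}

lemma derivative_hermite_succ (n : ℕ) :
    Polynomial.derivative (Polynomial.hermite (n + 1)) = (n + 1 : ℕ) • Polynomial.hermite n := by
  induction n with
  | zero => simp
  | succ n ih =>
    rw [Polynomial.hermite_succ (n + 1), Polynomial.derivative_sub, Polynomial.derivative_mul, ih,
      Polynomial.derivative_smul, Polynomial.derivative_X, Polynomial.hermite_succ n]
    simp only [nsmul_eq_mul, Nat.cast_add, Nat.cast_one]
    ring

/-- At `n = 0` the truncated index `n - 1` is harmless because the factor `n` vanishes. The same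
convention makes `α - Pi.single i 1` safe wherever it comes with the factor `α i`. -/
lemma derivative_hermite (n : ℕ) :
    Polynomial.derivative (Polynomial.hermite n) = n • Polynomial.hermite (n - 1) := by
  cases n with
  | zero => simp
  | succ n => simpa using derivative_hermite_succ n

lemma hermiteFun_split (α : Fin N → ℕ) (i : Fin N) (x : Sp N) :
    hermiteFun α x = Polynomial.aeval (x i) (Polynomial.hermite (α i)) *
      ∏ j ∈ Finset.univ.erase i, Polynomial.aeval (x j) (Polynomial.hermite (α j)) :=
  (Finset.mul_prod_erase _ _ (Finset.mem_univ i)).symm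

lemma hermiteFun_zero (x : Sp N) : hermiteFun 0 x = 1 := by
  simp [hermiteFun]

lemma hermiteFun_add_single (α : Fin N → ℕ) (i : Fin N) (x : Sp N) :
    hermiteFun (α + Pi.single i 1) x = x i * hermiteFun α x
      - α i * hermiteFun (α - Pi.single i 1) x := by
  have h1 : ∏ j ∈ Finset.univ.erase i, Polynomial.aeval (x j)
      (Polynomial.hermite ((α + Pi.single i 1 : Fin N → ℕ) j))
      = ∏ j ∈ Finset.univ.erase i, Polynomial.aeval (x j) (Polynomial.hermite (α j)) :=
    Finset.prod_congr rfl fun j hj => by simp [Finset.ne_of_mem_erase hj]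
  have h2 : ∏ j ∈ Finset.univ.erase i, Polynomial.aeval (x j)
      (Polynomial.hermite ((α - Pi.single i 1 : Fin N → ℕ) j))
      = ∏ j ∈ Finset.univ.erase i, Polynomial.aeval (x j) (Polynomial.hermite (α j)) :=
    Finset.prod_congr rfl fun j hj => by simp [Finset.ne_of_mem_erase hj]
  rw [hermiteFun_split _ i, h1, hermiteFun_split (α - Pi.single i 1) i, h2, hermiteFun_split α i]
  simp only [Pi.add_apply, Pi.single_eq_same, Pi.sub_apply, Polynomial.hermite_succ, map_sub,
    map_mul, Polynomial.aeval_X, derivative_hermite, nsmul_eq_mul, map_natCast]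
  ring

lemma coord_mul_hermiteFun (α : Fin N → ℕ) (i : Fin N) (x : Sp N) :
    x i * hermiteFun α x
      = hermiteFun (α + Pi.single i 1) x + α i * hermiteFun (α - Pi.single i 1) x := by
  rw [hermiteFun_add_single]
  ring

lemma contDiff_coord (i : Fin N) : ContDiff ℝ ∞ fun x : Sp N => x i :=
  (EuclideanSpace.proj (𝕜 := ℝ) i : Sp N →L[ℝ] ℝ).contDiff

lemma contDiff_hermiteFun (α : Fin N → ℕ) : ContDiff ℝ ∞ (hermiteFun α) := by
  refine contDiff_prod fun i _ => ?_
  exact (Polynomial.contDiff_aeval (Polynomial.hermite (α i)) ∞).comp (contDiff_coord i)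

lemma fderiv_hermiteFun (α : Fin N → ℕ) (i : Fin N) (x : Sp N) :
    fderiv ℝ (hermiteFun α) x (EuclideanSpace.single i 1)
      = α i * hermiteFun (α - Pi.single i 1) x := by
  rw [← ((contDiff_hermiteFun α).differentiable (by simp) x).lineDeriv_eq_fderiv, lineDeriv]
  have h0 : ∀ t : ℝ, hermiteFun α (x + t • EuclideanSpace.single i 1)
      = Polynomial.aeval (x i + t) (Polynomial.hermite (α i)) *
        ∏ j ∈ Finset.univ.erase i, Polynomial.aeval (x j) (Polynomial.hermite (α j)) := by
    intro t
    rw [hermiteFun_split _ i]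
    congr 1
    · simp
    · exact Finset.prod_congr rfl fun j hj => by simp [Finset.ne_of_mem_erase hj]
  have h2 : ∏ j ∈ Finset.univ.erase i, Polynomial.aeval (x j)
      (Polynomial.hermite ((α - Pi.single i 1 : Fin N → ℕ) j))
      = ∏ j ∈ Finset.univ.erase i, Polynomial.aeval (x j) (Polynomial.hermite (α j)) :=
    Finset.prod_congr rfl fun j hj => by simp [Finset.ne_of_mem_erase hj]
  simp only [h0]
  have h3 : HasDerivAt (fun t : ℝ => Polynomial.aeval (x i + t) (Polynomial.hermite (α i)))
      (Polynomial.aeval (x i) (Polynomial.derivative (Polynomial.hermite (α i)))) 0 := by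
    have := (Polynomial.hasDerivAt_aeval (Polynomial.hermite (α i)) (x i + 0)).comp_const_add
      (x i) 0
    simpa using this
  rw [(h3.mul_const _).deriv, hermiteFun_split (α - Pi.single i 1) i, h2, derivative_hermite]
  simp only [nsmul_eq_mul, map_mul, map_natCast, Pi.sub_apply, Pi.single_eq_same]
  ring

/-- Differentiating the polynomial gives `α_i H_{α-e_i}`, differentiating the weight gives `-x_i
H_α`; the sum is minus the recursion for `H_{α+e_i}`. -/
lemma fderiv_hermiteFun_mul_weight (α : Fin N → ℕ) (i : Fin N) (x : Sp N) :
    fderiv ℝ (fun x => hermiteFun α x * gaussWeight x) x (EuclideanSpace.single i 1)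
      = -(hermiteFun (α + Pi.single i 1) x * gaussWeight x) := by
  rw [fderiv_fun_mul ((contDiff_hermiteFun α).differentiable (by simp) x)
    (contDiff_gaussWeight.differentiable (by simp) x)]
  simp only [add_apply, smul_apply, fderiv_gaussWeight,
    fderiv_hermiteFun, hermiteFun_add_single, smul_eq_mul]
  ring

lemma expBounded_aeval_coord (q : Polynomial ℤ) (i : Fin N) :
    ExpBounded fun x : Sp N => Polynomial.aeval (x i) q := by
  induction q using Polynomial.induction_on with
  | C a => simpa using ExpBounded.const (a : ℝ)
  | add p q hp hq => simpa using hp.add hq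
  | monomial n a h =>
    have := h.mul (ExpBounded.coord i)
    simpa [pow_succ, mul_assoc] using this

lemma expBounded_hermiteFun (α : Fin N → ℕ) : ExpBounded (hermiteFun α) := by
  have : ∀ s : Finset (Fin N), ExpBounded fun x : Sp N =>
      ∏ i ∈ s, Polynomial.aeval (x i) (Polynomial.hermite (α i)) := by
    intro s
    induction s using Finset.induction_on with
    | empty => simpa using ExpBounded.const 1
    | insert a s ha ih =>
      simp only [Finset.prod_insert ha]
      exact (expBounded_aeval_coord _ a).mul ih
  exact this _

lemma memLp_hermiteFun (α : Fin N → ℕ) : MemLp (hermiteFun α) 2 (gaussMeasure N) :=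
  (expBounded_hermiteFun α).memLp

/-- The span of the Hermite polynomials. -/
def hermiteSpan (N : ℕ) : Submodule ℝ (Sp N → ℝ) := Submodule.span ℝ (Set.range hermiteFun)

lemma coord_mul_mem_hermiteSpan (i : Fin N) {p : Sp N → ℝ} (hp : p ∈ hermiteSpan N) :
    (fun x => x i * p x) ∈ hermiteSpan N := by
  let M : (Sp N → ℝ) →ₗ[ℝ] (Sp N → ℝ) := LinearMap.mulLeft ℝ (fun x : Sp N => x i)
  have hle : hermiteSpan N ≤ (hermiteSpan N).comap M := by
    refine Submodule.span_le.2 ?_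
    rintro _ ⟨α, rfl⟩
    have e : M (hermiteFun α) = hermiteFun (α + Pi.single i 1)
        + (α i : ℝ) • hermiteFun (α - Pi.single i 1) := by
      ext x
      exact coord_mul_hermiteFun α i x
    change M (hermiteFun α) ∈ hermiteSpan N
    rw [e]
    exact add_mem (Submodule.subset_span ⟨_, rfl⟩)
      (Submodule.smul_mem _ _ (Submodule.subset_span ⟨_, rfl⟩))
  exact hle hp

/-- Powers of linear forms are the terms of the exponential series of a character; no other
polynomials are needed for completeness. -/
lemma inner_pow_mem_hermiteSpan (t : Sp N) (n : ℕ) :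
    (fun x : Sp N => (inner ℝ x t) ^ n) ∈ hermiteSpan N := by
  induction n with
  | zero =>
    refine Submodule.subset_span ⟨0, ?_⟩
    ext x
    simp [hermiteFun_zero]
  | succ n ih =>
    have e : (fun x : Sp N => (inner ℝ x t) ^ (n + 1))
        = ∑ i, t i • fun x : Sp N => x i * (inner ℝ x t) ^ n := by
      ext x
      simp only [Finset.sum_apply, Pi.smul_apply, smul_eq_mul]
      rw [pow_succ, mul_comm, PiLp.inner_apply, Finset.sum_mul]
      refine Finset.sum_congr rfl fun i _ => ?_
      simp [mul_assoc]
    rw [e]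
    exact Submodule.sum_mem _ fun i _ =>
      Submodule.smul_mem _ _ (coord_mul_mem_hermiteSpan i ih)

end Hermite

/-! ### Weak divergence and integration by parts -/

section Divergence

variable {N : ℕ}

/-- The function `H` is the weak divergence of the vector field with components `v i`. -/
def IsWeakDiv (v : Fin N → Sp N → ℝ) (H : Sp N → ℝ) : Prop :=
  ∀ φ : Sp N → ℝ, ContDiff ℝ ∞ φ → HasCompactSupport φ →
    ∑ i, ∫ x, v i x * fderiv ℝ φ x (EuclideanSpace.single i 1) = - ∫ x, H x * φ x

/-- A scaling sequence that tends to zero. -/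
lemma tendsto_inv_succ : Tendsto (fun n : ℕ => ((n : ℝ) + 1)⁻¹) atTop (𝓝 0) := by
  simpa [one_div] using tendsto_one_div_add_atTop_nhds_zero_nat (𝕜 := ℝ)

lemma tendsto_integral_mul_dilation {F p : Sp N → ℝ} (hF : Integrable F) (hp : Continuous p)
    {C : ℝ} (hC : ∀ x, ‖p x‖ ≤ C) :
    Tendsto (fun n : ℕ => ∫ x, F x * p (((n : ℝ) + 1)⁻¹ • x)) atTop (𝓝 (∫ x, F x * p 0)) := by
  refine tendsto_integral_of_dominated_convergence (fun x => ‖F x‖ * C) (fun n => ?_)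
    (hF.norm.mul_const C) (fun n => Eventually.of_forall fun x => ?_)
    (Eventually.of_forall fun x => ?_)
  · exact hF.aestronglyMeasurable.mul
      (hp.comp (continuous_const_smul _)).aestronglyMeasurable
  · rw [norm_mul]
    gcongr
    exact hC _
  · have h0 : Tendsto (fun n : ℕ => ((n : ℝ) + 1)⁻¹ • x) atTop (𝓝 0) := by
      simpa using tendsto_inv_succ.smul_const x
    exact ((hp.tendsto 0).comp h0).const_mul (F x)

lemma integrable_mul_dilation {F p : Sp N → ℝ} (hF : Integrable F) (hp : Continuous p)
    {C : ℝ} (hC : ∀ x, ‖p x‖ ≤ C) (c : ℝ) : Integrable fun x => F x * p (c • x) := by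
  refine (hF.norm.mul_const C).mono' (hF.aestronglyMeasurable.mul
    (hp.comp (continuous_const_smul _)).aestronglyMeasurable) (Eventually.of_forall fun x => ?_)
  rw [norm_mul]
  gcongr
  exact hC _

/-- Integration by parts against test functions without compact support. -/
lemma IsWeakDiv.sum_integral_eq {v : Fin N → Sp N → ℝ} {H φ : Sp N → ℝ} (h : IsWeakDiv v H)
    (hφ : ContDiff ℝ ∞ φ) (h1 : ∀ i, Integrable fun x => v i x * φ x)
    (h2 : ∀ i, Integrable fun x => v i x * fderiv ℝ φ x (EuclideanSpace.single i 1))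
    (h3 : Integrable fun x => H x * φ x) :
    ∑ i, ∫ x, v i x * fderiv ℝ φ x (EuclideanSpace.single i 1) = - ∫ x, H x * φ x := by
  -- The test function is cut off by `χ (x / (n + 1))`. A derivative that falls on the cutoff brings
  -- a factor `1 / (n + 1)`, so these terms disappear in the limit, and the others converge by
  -- domination.
  let χ : ContDiffBump (0 : Sp N) := ⟨1, 2, one_pos, one_lt_two⟩
  have hχ : ContDiff ℝ ∞ χ := χ.contDiff
  have hχc : HasCompactSupport χ := χ.hasCompactSupport
  have hχ0 : χ 0 = 1 := χ.one_of_mem_closedBall (by simp [χ])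
  have hd : ∀ i, Continuous fun x => fderiv ℝ χ x (EuclideanSpace.single i 1) := fun i =>
    (hχ.continuous_fderiv (by simp)).clm_apply continuous_const
  have hdc : ∀ i : Fin N, HasCompactSupport fun x => fderiv ℝ χ x (EuclideanSpace.single i 1) :=
    fun i => hχc.fderiv_apply ℝ _
  obtain ⟨C, hC⟩ := hχc.exists_bound_of_continuous hχ.continuous
  choose D hD using fun i => (hdc i).exists_bound_of_continuous (hd i)
  have key : ∀ n : ℕ, (∑ i, (((n : ℝ) + 1)⁻¹ * (∫ x, (v i x * φ x) *
      fderiv ℝ χ (((n : ℝ) + 1)⁻¹ • x) (EuclideanSpace.single i 1))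
      + ∫ x, (v i x * fderiv ℝ φ x (EuclideanSpace.single i 1)) * χ (((n : ℝ) + 1)⁻¹ • x)))
      = - ∫ x, (H x * φ x) * χ (((n : ℝ) + 1)⁻¹ • x) := by
    intro n
    set c : ℝ := ((n : ℝ) + 1)⁻¹ with hc
    have hc0 : c ≠ 0 := by positivity
    have hs : ContDiff ℝ ∞ fun x : Sp N => χ (c • x) := hχ.comp (contDiff_const_smul c)
    have hsc : HasCompactSupport fun x : Sp N => χ (c • x) := hχc.comp_smul hc0
    have ht := h (fun x => φ x * χ (c • x)) (hφ.mul hs) hsc.mul_left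
    have e : - ∫ x, (H x * φ x) * χ (c • x) = - ∫ x, H x * (φ x * χ (c • x)) := by
      simp only [mul_assoc]
    rw [e, ← ht]
    refine Finset.sum_congr rfl fun i _ => ?_
    rw [← integral_const_mul, ← integral_add
      ((integrable_mul_dilation (h1 i) (hd i) (hD i) c).const_mul c)
      (integrable_mul_dilation (h2 i) hχ.continuous hC c)]
    refine integral_congr_ae (Eventually.of_forall fun x => ?_)
    have hcomp : fderiv ℝ (fun x : Sp N => χ (c • x)) x (EuclideanSpace.single i 1)
        = c * fderiv ℝ χ (c • x) (EuclideanSpace.single i 1) := by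
      have h4 := (hχ.differentiable (by simp) (c • x)).hasFDerivAt.comp x
        ((hasFDerivAt_id x).const_smul c)
      have h5 : fderiv ℝ (fun x : Sp N => χ (c • x)) x = _ := h4.fderiv
      rw [h5]
      simp
    simp only
    rw [fderiv_fun_mul (hφ.differentiable (by simp) x) (hs.differentiable (by simp) x)]
    simp only [add_apply, smul_apply, hcomp, smul_eq_mul]
    ring
  have l1 : Tendsto (fun n : ℕ => ∑ i, (((n : ℝ) + 1)⁻¹ * (∫ x, (v i x * φ x) *
      fderiv ℝ χ (((n : ℝ) + 1)⁻¹ • x) (EuclideanSpace.single i 1))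
      + ∫ x, (v i x * fderiv ℝ φ x (EuclideanSpace.single i 1)) * χ (((n : ℝ) + 1)⁻¹ • x)))
      atTop (𝓝 (∑ i, ∫ x, v i x * fderiv ℝ φ x (EuclideanSpace.single i 1))) := by
    refine tendsto_finsetSum _ fun i _ => ?_
    have a := tendsto_inv_succ.mul (tendsto_integral_mul_dilation (h1 i) (hd i) (hD i))
    have b := tendsto_integral_mul_dilation (h2 i) hχ.continuous hC
    simpa [hχ0] using a.add b
  have l2 := (tendsto_integral_mul_dilation h3 hχ.continuous hC).neg
  simp only [hχ0, mul_one] at l2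
  exact tendsto_nhds_unique l1 (by simpa only [key] using l2)

lemma HasWeakPartial.isWeakDiv {i : Fin N} {u g : Sp N → ℝ} (h : HasWeakPartial i u g) :
    IsWeakDiv (Pi.single i u) g := by
  intro φ hφ hc
  rw [Finset.sum_eq_single i, Pi.single_eq_same, h.3 φ hφ hc]
  · intro j _ hj
    simp [Pi.single_eq_of_ne hj]
  · simp

lemma hasWeakPartial_of_contDiff {i : Fin N} {u : Sp N → ℝ} (hu : ContDiff ℝ ∞ u) :
    HasWeakPartial i u fun x => fderiv ℝ u x (EuclideanSpace.single i 1) := by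
  have hg : Continuous fun x => fderiv ℝ u x (EuclideanSpace.single i 1) :=
    (hu.continuous_fderiv (by simp)).clm_apply continuous_const
  refine ⟨hu.continuous.locallyIntegrable, hg.locallyIntegrable, fun φ hφ hc => ?_⟩
  exact integral_mul_fderiv_eq_neg_fderiv_mul_of_integrable
    (integrable_mul_test hg.locallyIntegrable hφ.continuous hc)
    (integrable_mul_fderiv_test hu.continuous.locallyIntegrable hφ hc _)
    (integrable_mul_test hu.continuous.locallyIntegrable hφ.continuous hc)
    (fun x _ => hu.differentiable (by simp) x) (fun x _ => hφ.differentiable (by simp) x)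

/-- Mixed second derivatives commute: the field `∂_i ψ e_j - ∂_j ψ e_i` is divergence free. -/
lemma HasWeakPartial.isWeakDiv_rotate {i j : Fin N} (hij : i ≠ j) {u a b : Sp N → ℝ}
    (ha : HasWeakPartial i u a) (hb : HasWeakPartial j u b) :
    IsWeakDiv (Pi.single j a + Pi.single i (fun x => -b x)) (fun _ => 0) := by
  intro φ hφ hc
  have hd : ∀ k : Fin N, ContDiff ℝ ∞ fun x => fderiv ℝ φ x (EuclideanSpace.single k 1) :=
    fun k => (hφ.fderiv_right (m := ∞) (by simp)).clm_apply contDiff_const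
  have hdc : ∀ k : Fin N, HasCompactSupport fun x => fderiv ℝ φ x (EuclideanSpace.single k 1) :=
    fun k => hc.fderiv_apply ℝ _
  have hle : (2 : WithTop ℕ∞) ≤ ∞ := ENat.LEInfty.out
  -- The commutation takes place on the smooth test function; `u` needs only first weak derivatives.
  have hsymm : ∀ x, fderiv ℝ (fun y => fderiv ℝ φ y (EuclideanSpace.single j 1)) x
      (EuclideanSpace.single i 1) = fderiv ℝ (fun y => fderiv ℝ φ y (EuclideanSpace.single i 1)) x
      (EuclideanSpace.single j 1) := by
    intro x
    have hdd : DifferentiableAt ℝ (fderiv ℝ φ) x :=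
      (hφ.fderiv_right (m := 1) (by simpa [one_add_one_eq_two] using hle)).differentiable (by simp) x
    rw [fderiv_clm_apply hdd (differentiableAt_const _),
      fderiv_clm_apply hdd (differentiableAt_const _)]
    have := (hφ.contDiffAt (x := x)).isSymmSndFDerivAt (by simpa using hle)
    simpa using this (EuclideanSpace.single i 1) (EuclideanSpace.single j 1)
  have e1 := ha.3 _ (hd j) (hdc j)
  have e2 := hb.3 _ (hd i) (hdc i)
  simp only [hsymm] at e1
  have e3 : ∑ k, ∫ x, (Pi.single j a + Pi.single i (fun x => -b x) : Fin N → Sp N → ℝ) k x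
        * fderiv ℝ φ x (EuclideanSpace.single k 1)
      = (∫ x, a x * fderiv ℝ φ x (EuclideanSpace.single j 1))
        + ∫ x, -b x * fderiv ℝ φ x (EuclideanSpace.single i 1) := by
    rw [← Finset.sum_subset (Finset.subset_univ {j, i}), Finset.sum_pair hij.symm]
    · simp [hij, hij.symm]
    · intro k _ hk
      simp only [Finset.mem_insert, Finset.mem_singleton, not_or] at hk
      simp [Pi.single_eq_of_ne hk.1, Pi.single_eq_of_ne hk.2]
  rw [e3]
  simp only [neg_mul, integral_neg, zero_mul, integral_zero, neg_zero]
  linarith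

lemma IsWeakDiv.congr {v : Fin N → Sp N → ℝ} {H K : Sp N → ℝ} (h : IsWeakDiv v H)
    (hK : H =ᵐ[volume] K) : IsWeakDiv v K := by
  intro φ hφ hc
  rw [h φ hφ hc]
  congr 1
  apply integral_congr_ae
  filter_upwards [hK] with x hx
  rw [hx]

/-- In the Ornstein-Uhlenbeck equation a single second derivative has no known global integrability,
whereas their sum equals `x·∇u - f` and does. This is why integration by parts is set up for
divergences. -/
lemma isWeakDiv_sum {v h : Fin N → Sp N → ℝ} (hv : ∀ i, HasWeakPartial i (v i) (h i)) :
    IsWeakDiv v fun x => ∑ i, h i x := by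
  intro φ hφ hc
  simp only [Finset.sum_mul]
  rw [integral_finsetSum _ fun i _ => integrable_mul_test (hv i).2 hφ.continuous hc,
    ← Finset.sum_neg_distrib]
  exact Finset.sum_congr rfl fun i _ => (hv i).3 φ hφ hc

end Divergence

/-! ### Hermite coefficients -/

section Coefficients

variable {N : ℕ}

/-- The (not normalized) Hermite coefficients of a function. -/
def hermiteCoeff (u : Sp N → ℝ) (α : Fin N → ℕ) : ℝ := ∫ x, u x * hermiteFun α x ∂gaussMeasure N

lemma hermiteCoeff_congr {u v : Sp N → ℝ} (h : u =ᵐ[gaussMeasure N] v) (α : Fin N → ℕ) :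
    hermiteCoeff u α = hermiteCoeff v α := by
  apply integral_congr_ae
  filter_upwards [h] with x hx
  rw [hx]

lemma ExpIntegrable.integrable_mul_hermite {u : Sp N → ℝ} (hu : ExpIntegrable u) (α : Fin N → ℕ) :
    Integrable (fun x => u x * hermiteFun α x) (gaussMeasure N) :=
  (hu.mul (expBounded_hermiteFun α)).integrable

lemma hermiteCoeff_add {u v : Sp N → ℝ} (hu : ExpIntegrable u) (hv : ExpIntegrable v)
    (α : Fin N → ℕ) :
    hermiteCoeff (fun x => u x + v x) α = hermiteCoeff u α + hermiteCoeff v α := by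
  simp only [hermiteCoeff, add_mul]
  exact integral_add (hu.integrable_mul_hermite α) (hv.integrable_mul_hermite α)

lemma hermiteCoeff_sum {ι : Type*} (s : Finset ι) {u : ι → Sp N → ℝ}
    (hu : ∀ i ∈ s, ExpIntegrable (u i)) (α : Fin N → ℕ) :
    hermiteCoeff (fun x => ∑ i ∈ s, u i x) α = ∑ i ∈ s, hermiteCoeff (u i) α := by
  simp only [hermiteCoeff, Finset.sum_mul]
  exact integral_finsetSum _ fun i hi => (hu i hi).integrable_mul_hermite α

lemma hermiteCoeff_neg (u : Sp N → ℝ) (α : Fin N → ℕ) :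
    hermiteCoeff (fun x => -u x) α = -hermiteCoeff u α := by
  simp only [hermiteCoeff, neg_mul, integral_neg]

lemma hermiteCoeff_const_mul (c : ℝ) (u : Sp N → ℝ) (α : Fin N → ℕ) :
    hermiteCoeff (fun x => c * u x) α = c * hermiteCoeff u α := by
  simp only [hermiteCoeff, mul_assoc, integral_const_mul]

lemma hermiteCoeff_comm (α β : Fin N → ℕ) :
    hermiteCoeff (hermiteFun α) β = hermiteCoeff (hermiteFun β) α := by
  simp only [hermiteCoeff, mul_comm]

lemma hermiteCoeff_coord_mul {u : Sp N → ℝ} (hu : ExpIntegrable u) (i : Fin N) (α : Fin N → ℕ) :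
    hermiteCoeff (fun x => x i * u x) α = hermiteCoeff u (α + Pi.single i 1)
      + α i * hermiteCoeff u (α - Pi.single i 1) := by
  have e : ∀ x, x i * u x * hermiteFun α x = u x * hermiteFun (α + Pi.single i 1) x
      + α i * (u x * hermiteFun (α - Pi.single i 1) x) := by
    intro x
    rw [hermiteFun_add_single]
    ring
  simp only [hermiteCoeff, e]
  rw [integral_add (hu.integrable_mul_hermite _) ((hu.integrable_mul_hermite _).const_mul _),
    integral_const_mul]

/-- The test function is `H_α w`, whose gradient has the components `-H_{α+e_i} w`. -/
lemma IsWeakDiv.sum_hermiteCoeff {v : Fin N → Sp N → ℝ} {H : Sp N → ℝ} (h : IsWeakDiv v H)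
    (hv : ∀ i, ExpIntegrable (v i)) (hH : ExpIntegrable H) (α : Fin N → ℕ) :
    ∑ i, hermiteCoeff (v i) (α + Pi.single i 1) = hermiteCoeff H α := by
  have key := h.sum_integral_eq (φ := fun x => hermiteFun α x * gaussWeight x)
    ((contDiff_hermiteFun α).mul contDiff_gaussWeight)
    (fun i => (hv i).integrable_mul_weight (expBounded_hermiteFun α))
    (fun i => by
      simp only [fderiv_hermiteFun_mul_weight, mul_neg]
      exact ((hv i).integrable_mul_weight (expBounded_hermiteFun _)).neg)
    (hH.integrable_mul_weight (expBounded_hermiteFun α))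
  simp only [fderiv_hermiteFun_mul_weight, mul_neg, integral_neg, Finset.sum_neg_distrib,
    neg_inj] at key
  simpa only [hermiteCoeff, integral_gaussMeasure, mul_assoc] using key

lemma HasWeakPartial.hermiteCoeff_eq {i : Fin N} {u g : Sp N → ℝ} (h : HasWeakPartial i u g)
    (hu : ExpIntegrable u) (hg : ExpIntegrable g) (α : Fin N → ℕ) :
    hermiteCoeff g α = hermiteCoeff u (α + Pi.single i 1) := by
  have h0 : ExpIntegrable fun _ : Sp N => (0 : ℝ) := fun a => by simp
  rw [← h.isWeakDiv.sum_hermiteCoeff (fun j => ?_) hg α, Finset.sum_eq_single i,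
    Pi.single_eq_same]
  · intro j _ hj
    simp [Pi.single_eq_of_ne hj, hermiteCoeff]
  · simp
  · by_cases hj : j = i
    · subst hj
      simpa using hu
    · rw [Pi.single_eq_of_ne hj]
      exact h0

/-- Both sides would be the coefficient of `u` at `α + e_i + e_j`, but `u` is only locally
integrable here and may have no coefficients. The divergence-free field `a e_j - b e_i` gives the
equality without them. -/
lemma HasWeakPartial.hermiteCoeff_rotate {i j : Fin N} {u a b : Sp N → ℝ}
    (ha : HasWeakPartial i u a) (hb : HasWeakPartial j u b) (ha' : ExpIntegrable a)
    (hb' : ExpIntegrable b) (α : Fin N → ℕ) :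
    hermiteCoeff a (α + Pi.single j 1) = hermiteCoeff b (α + Pi.single i 1) := by
  have h0 : ExpIntegrable fun _ : Sp N => (0 : ℝ) := fun a => by simp
  by_cases hij : i = j
  · subst hij
    exact hermiteCoeff_congr (gaussMeasure_ac.ae_eq (ha.unique hb (ae_eq_refl u))) _
  · have := (ha.isWeakDiv_rotate hij hb).sum_hermiteCoeff (fun k => ?_) h0 α
    · rw [← Finset.sum_subset (Finset.subset_univ {j, i}), Finset.sum_pair (Ne.symm hij)] at this
      · simp only [Pi.add_apply, Pi.single_eq_same, Pi.single_eq_of_ne hij,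
          Pi.single_eq_of_ne (Ne.symm hij), add_zero, zero_add] at this
        rw [hermiteCoeff_neg] at this
        simp only [hermiteCoeff, zero_mul, integral_zero] at this ⊢
        linarith
      · intro k _ hk
        simp only [Finset.mem_insert, Finset.mem_singleton, not_or] at hk
        simp [Pi.single_eq_of_ne hk.1, Pi.single_eq_of_ne hk.2, hermiteCoeff]
    · by_cases hk : k = j
      · subst hk
        simpa [Pi.single_eq_of_ne (Ne.symm hij)] using ha'
      · by_cases hk' : k = i
        · subst hk'
          simpa [Pi.single_eq_of_ne hk] using hb'.neg
        · simpa [Pi.single_eq_of_ne hk, Pi.single_eq_of_ne hk'] using! h0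

/-- The gradient has divergence `x·g - f`. Its coefficients are `∑ c_{α+e_i}(g_i)` by integration by
parts, and multiplication by `x_i` produces the same raised terms plus `α_i c_{α-e_i}(g_i)`. The
raised terms cancel. No integrability of `u` itself enters. -/
lemma IsOrnsteinUhlenbeck.hermiteCoeff_eq {u f : Sp N → ℝ} {g : Fin N → Sp N → ℝ}
    (h : IsOrnsteinUhlenbeck u f) (hug : ∀ i, HasWeakPartial i u (g i))
    (hg : ∀ i, ExpIntegrable (g i)) (hf : ExpIntegrable f) (α : Fin N → ℕ) :
    hermiteCoeff f α = ∑ i, α i * hermiteCoeff (g i) (α - Pi.single i 1) := by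
  obtain ⟨g', k, h1, h2, h3⟩ := h
  have hgg : ∀ i, g' i =ᵐ[volume] g i := fun i => (h1 i).unique (hug i) (ae_eq_refl u)
  have hg' : ∀ i, ExpIntegrable (g' i) := fun i =>
    (hg i).congr (gaussMeasure_ac.ae_eq (hgg i).symm)
  have hx : ∀ i, ExpIntegrable fun x : Sp N => x i * g' i x := fun i => by
    simpa only [mul_comm] using (hg' i).mul (ExpBounded.coord i)
  have hs := ExpIntegrable.sum Finset.univ fun i _ => hx i
  have hdiv := (isWeakDiv_sum h2).congr (K := fun x => ∑ i, x i * g' i x + -f x) (by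
    filter_upwards [h3] with x e
    rw [e]
    ring)
  have := hdiv.sum_hermiteCoeff hg' (hs.add hf.neg) α
  rw [hermiteCoeff_add hs hf.neg, hermiteCoeff_neg, hermiteCoeff_sum _ fun i _ => hx i] at this
  simp only [hermiteCoeff_coord_mul (hg' _), Finset.sum_add_distrib] at this
  simp only [← hermiteCoeff_congr (gaussMeasure_ac.ae_eq (hgg _))]
  linarith

end Coefficients

/-! ### Completeness of the Hermite polynomials -/

section Completeness

variable {N : ℕ}

lemma integral_mul_eq_zero_of_mem_hermiteSpan {F p : Sp N → ℝ} (hF : ExpIntegrable F)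
    (h : ∀ α, hermiteCoeff F α = 0) (hp : p ∈ hermiteSpan N) :
    Integrable (fun x => F x * p x) (gaussMeasure N) ∧ ∫ x, F x * p x ∂gaussMeasure N = 0 := by
  induction hp using Submodule.span_induction with
  | mem p hp =>
    obtain ⟨α, rfl⟩ := hp
    exact ⟨hF.integrable_mul_hermite α, h α⟩
  | zero => simp
  | add p q _ _ hp hq =>
    simp only [Pi.add_apply, mul_add]
    exact ⟨hp.1.add hq.1, by rw [integral_add hp.1 hq.1, hp.2, hq.2, add_zero]⟩
  | smul c p _ hp =>
    simp only [Pi.smul_apply, smul_eq_mul, mul_left_comm _ c]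
    exact ⟨hp.1.const_mul c, by rw [integral_const_mul, hp.2, mul_zero]⟩

/-- Expand the character in its power series. Every term integrates to zero, and the partial sums
are dominated by `|F x| exp(‖t‖‖x‖)`, which is integrable by assumption on `F`. -/
lemma integral_mul_cexp_eq_zero {F : Sp N → ℝ} (hF : ExpIntegrable F)
    (h : ∀ α, hermiteCoeff F α = 0) (t : Sp N) :
    ∫ x, (F x : ℂ) * Complex.exp ((inner ℝ x t : ℝ) * Complex.I) ∂gaussMeasure N = 0 := by
  have hterm : ∀ (n : ℕ) (x : Sp N),
      (F x : ℂ) * ((((inner ℝ x t : ℝ) : ℂ) * Complex.I) ^ n / (n.factorial : ℂ))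
        = (Complex.I ^ n / (n.factorial : ℂ)) * ((F x * (inner ℝ x t) ^ n : ℝ) : ℂ) := by
    intro n x
    push_cast
    ring
  have hsum : ∀ x : Sp N, HasSum (fun n : ℕ => |F x| * ((‖t‖ * ‖x‖) ^ n / n.factorial))
      (|F x| * Real.exp (‖t‖ * ‖x‖)) := by
    intro x
    rw [Real.exp_eq_exp_ℝ]
    exact (NormedSpace.expSeries_div_hasSum_exp (‖t‖ * ‖x‖)).mul_left _
  have key := hasSum_integral_of_dominated_convergence (μ := gaussMeasure N)
    (F := fun (n : ℕ) (x : Sp N) =>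
      (F x : ℂ) * ((((inner ℝ x t : ℝ) : ℂ) * Complex.I) ^ n / (n.factorial : ℂ)))
    (f := fun x => (F x : ℂ) * Complex.exp ((inner ℝ x t : ℝ) * Complex.I))
    (fun n x => |F x| * ((‖t‖ * ‖x‖) ^ n / n.factorial)) (fun n => ?_)
    (fun n => Eventually.of_forall fun x => ?_)
    (Eventually.of_forall fun x => (hsum x).summable) ?_
    (Eventually.of_forall fun x => ?_)
  · have hz : ∀ n : ℕ, ∫ x, (F x : ℂ) * ((((inner ℝ x t : ℝ) : ℂ) * Complex.I) ^ n /
        (n.factorial : ℂ)) ∂gaussMeasure N = 0 := by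
      intro n
      simp only [hterm]
      rw [integral_const_mul, integral_complex_ofReal,
        (integral_mul_eq_zero_of_mem_hermiteSpan hF h (inner_pow_mem_hermiteSpan t n)).2]
      simp
    simp only [hz] at key
    exact key.unique hasSum_zero
  · refine (Complex.continuous_ofReal.comp_aestronglyMeasurable hF.aestronglyMeasurable).mul ?_
    exact (by fun_prop : Continuous fun x : Sp N =>
      (((inner ℝ x t : ℝ) : ℂ) * Complex.I) ^ n / (n.factorial : ℂ)).aestronglyMeasurable
  · rw [norm_mul, norm_div, norm_pow, norm_mul, Complex.norm_I, mul_one, Complex.norm_real,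
      Complex.norm_real, Complex.norm_natCast, Real.norm_eq_abs (F x)]
    gcongr
    rw [mul_comm]
    exact norm_inner_le_norm x t
  · simp only [(hsum _).tsum_eq]
    simpa [abs_mul] using (hF ‖t‖).norm
  · refine HasSum.mul_left _ ?_
    rw [Complex.exp_eq_exp_ℂ]
    exact NormedSpace.expSeries_div_hasSum_exp _

/-- Functions whose Hermite coefficients all vanish are zero. -/
lemma ae_eq_zero_of_hermiteCoeff_eq_zero {F : Sp N → ℝ} (hF : ExpIntegrable F)
    (h : ∀ α, hermiteCoeff F α = 0) : F =ᵐ[gaussMeasure N] 0 := by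
  have hi := hF.integrable
  have hm : AEMeasurable F (gaussMeasure N) := hF.aestronglyMeasurable.aemeasurable
  have hpm : AEMeasurable (fun x => ENNReal.ofReal (F x)) (gaussMeasure N) := hm.ennreal_ofReal
  have hnm : AEMeasurable (fun x => ENNReal.ofReal (-F x)) (gaussMeasure N) :=
    hm.neg.ennreal_ofReal
  have f1 : IsFiniteMeasure ((gaussMeasure N).withDensity fun x => ENNReal.ofReal (F x)) :=
    isFiniteMeasure_withDensity_ofReal hi.2
  have f2 : IsFiniteMeasure ((gaussMeasure N).withDensity fun x => ENNReal.ofReal (-F x)) :=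
    isFiniteMeasure_withDensity_ofReal hi.neg.2
  -- The positive and negative parts of `F` are densities of finite measures. Their characteristic
  -- functions differ by the integral of `F` against a character, which vanishes, so the measures
  -- coincide.
  have e : (gaussMeasure N).withDensity (fun x => ENNReal.ofReal (F x))
      = (gaussMeasure N).withDensity (fun x => ENNReal.ofReal (-F x)) := by
    refine Measure.ext_of_charFun ?_
    funext t
    rw [charFun_apply, charFun_apply, integral_withDensity_eq_integral_toReal_smul₀ hpm
      (Eventually.of_forall fun x => ENNReal.ofReal_lt_top),
      integral_withDensity_eq_integral_toReal_smul₀ hnm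
      (Eventually.of_forall fun x => ENNReal.ofReal_lt_top), ← sub_eq_zero]
    have hb : ∀ {g : Sp N → ℝ}, Integrable g (gaussMeasure N) → Integrable (fun x =>
        (ENNReal.ofReal (g x)).toReal • Complex.exp ((inner ℝ x t : ℝ) * Complex.I))
        (gaussMeasure N) := by
      intro g hg
      have h1 : Integrable (fun x => (ENNReal.ofReal (g x)).toReal) (gaussMeasure N) := by
        simpa only [ENNReal.toReal_ofReal'] using hg.pos_part
      refine h1.norm.mono' (h1.aestronglyMeasurable.smul (by fun_prop : Continuous fun x : Sp N =>
        Complex.exp ((inner ℝ x t : ℝ) * Complex.I)).aestronglyMeasurable)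
        (Eventually.of_forall fun x => ?_)
      rw [norm_smul, Complex.norm_exp_ofReal_mul_I, mul_one]
    rw [← integral_sub (hb hi) (hb (g := fun x => -F x) hi.neg), ← integral_mul_cexp_eq_zero hF h t]
    refine integral_congr_ae (Eventually.of_forall fun x => ?_)
    simp only [ENNReal.toReal_ofReal', ← sub_smul]
    rw [max_zero_sub_eq_self]
    simp
  rw [withDensity_eq_iff hpm hnm] at e
  · filter_upwards [e] with x hx
    rcases le_total 0 (F x) with h0 | h0
    · rw [ENNReal.ofReal_of_nonpos (neg_nonpos.2 h0), ENNReal.ofReal_eq_zero] at hx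
      exact le_antisymm hx h0
    · rw [ENNReal.ofReal_of_nonpos h0, eq_comm, ENNReal.ofReal_eq_zero] at hx
      exact le_antisymm h0 (neg_nonpos.1 hx)
  · rw [← setLIntegral_univ, ← withDensity_apply _ MeasurableSet.univ]
    exact measure_ne_top _ _

end Completeness

/-! ### Orthogonality and the Hermite basis -/

section HermiteBasis

variable {N : ℕ}

lemma add_single_sub_single (α : Fin N → ℕ) (i : Fin N) :
    α + Pi.single i 1 - Pi.single i 1 = α := add_tsub_cancel_right _ _

lemma sub_single_add_single {α : Fin N → ℕ} {i : Fin N} (h : α i ≠ 0) :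
    α - Pi.single i 1 + Pi.single i 1 = α := by
  ext j
  by_cases hj : j = i
  · subst hj
    simp
    omega
  · simp [hj]

lemma add_single_injective (i : Fin N) :
    Function.Injective fun β : Fin N → ℕ => β + Pi.single i 1 := add_left_injective _

/-- A series whose terms carry a factor `α i` lives on the range of the shift and may be reindexed
by `α = β + e_i`. -/
lemma apply_eq_zero_of_notMem_range {i : Fin N} {α : Fin N → ℕ}
    (h : α ∉ Set.range fun β : Fin N → ℕ => β + Pi.single i 1) : α i = 0 := by
  by_contra h0
  exact h ⟨_, sub_single_add_single h0⟩

lemma hasWeakPartial_hermiteFun (α : Fin N → ℕ) (i : Fin N) :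
    HasWeakPartial i (hermiteFun α) fun x => α i * hermiteFun (α - Pi.single i 1) x := by
  simpa only [fderiv_hermiteFun] using hasWeakPartial_of_contDiff (i := i) (contDiff_hermiteFun α)

lemma hermiteCoeff_hermiteFun_add_single (α β : Fin N → ℕ) (i : Fin N) :
    hermiteCoeff (hermiteFun α) (β + Pi.single i 1)
      = α i * hermiteCoeff (hermiteFun (α - Pi.single i 1)) β := by
  rw [← (hasWeakPartial_hermiteFun α i).hermiteCoeff_eq (expBounded_hermiteFun α).expIntegrable
    ((ExpBounded.const _).mul (expBounded_hermiteFun _)).expIntegrable, hermiteCoeff_const_mul]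

/-- At an index with `α_i ≠ β_i`, lowering from either side shows that the pairing is both `α_i` and
`β_i` times the pairing of `H_{α-e_i}` and `H_{β-e_i}`, which must then vanish. If one of `α_i`,
`β_i` is zero, a single lowering suffices. -/
lemma hermiteCoeff_hermiteFun_of_ne {α β : Fin N → ℕ} (h : α ≠ β) :
    hermiteCoeff (hermiteFun α) β = 0 := by
  obtain ⟨i, hi⟩ := Function.ne_iff.1 h
  by_cases hβ : β i = 0
  · have hα : α i ≠ 0 := fun e => hi (e.trans hβ.symm)
    rw [hermiteCoeff_comm, ← sub_single_add_single hα, hermiteCoeff_hermiteFun_add_single, hβ]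
    simp
  · by_cases hα : α i = 0
    · rw [← sub_single_add_single hβ, hermiteCoeff_hermiteFun_add_single, hα]
      simp
    · have h1 := hermiteCoeff_hermiteFun_add_single α (β - Pi.single i 1) i
      have h2 := hermiteCoeff_hermiteFun_add_single β (α - Pi.single i 1) i
      rw [sub_single_add_single hβ] at h1
      rw [sub_single_add_single hα, hermiteCoeff_comm β, hermiteCoeff_comm (β - _), h1] at h2
      rw [h1]
      have h3 : ((α i : ℝ) - β i) *
          hermiteCoeff (hermiteFun (α - Pi.single i 1)) (β - Pi.single i 1) = 0 := by linarith
      rcases mul_eq_zero.1 h3 with h4 | h4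
      · exact absurd (Nat.cast_injective (sub_eq_zero.1 h4)) hi
      · rw [h4, mul_zero]

/-- The square of the norm of a Hermite polynomial. -/
def hermiteNormSq (α : Fin N → ℕ) : ℝ := hermiteCoeff (hermiteFun α) α

lemma hermiteNormSq_add_single (α : Fin N → ℕ) (i : Fin N) :
    hermiteNormSq (α + Pi.single i 1) = (α i + 1) * hermiteNormSq α := by
  rw [hermiteNormSq, hermiteCoeff_hermiteFun_add_single, add_single_sub_single, hermiteNormSq]
  simp

lemma hermiteNormSq_sub_single {α : Fin N → ℕ} {i : Fin N} (h : α i ≠ 0) :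
    hermiteNormSq α = α i * hermiteNormSq (α - Pi.single i 1) := by
  have h1 := hermiteNormSq_add_single (α - Pi.single i 1) i
  rw [sub_single_add_single h] at h1
  rw [h1]
  congr 1
  have : 1 ≤ α i := Nat.one_le_iff_ne_zero.2 h
  simp [Nat.cast_sub this]

lemma sum_sub_single {α : Fin N → ℕ} {i : Fin N} (h : α i ≠ 0) :
    ∑ j, (α - Pi.single i 1 : Fin N → ℕ) j + 1 = ∑ j, α j := by
  conv_rhs => rw [← sub_single_add_single h]
  simp [Finset.sum_add_distrib]

lemma hermiteNormSq_pos (α : Fin N → ℕ) : 0 < hermiteNormSq α := by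
  induction hn : ∑ j, α j generalizing α with
  | zero =>
    have h0 : α = 0 := by
      ext i
      simpa using (Finset.sum_eq_zero_iff.1 hn) i (Finset.mem_univ i)
    subst h0
    simp only [hermiteNormSq, hermiteCoeff, hermiteFun_zero, mul_one]
    rw [integral_const, smul_eq_mul, mul_one, measureReal_def]
    refine ENNReal.toReal_pos ?_ (measure_ne_top _ _)
    rw [Ne, Measure.measure_univ_eq_zero]
    intro h
    have := ac_gaussMeasure (N := N)
    rw [h, Measure.absolutelyContinuous_zero_iff] at this
    exact NeZero.ne _ this
  | succ n ih =>
    obtain ⟨i, hi⟩ : ∃ i, α i ≠ 0 := by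
      by_contra! h
      simp [h] at hn
    rw [hermiteNormSq_sub_single hi]
    have := ih (α - Pi.single i 1) (by have := sum_sub_single hi; omega)
    have : 0 < (α i : ℝ) := by exact_mod_cast Nat.pos_of_ne_zero hi
    positivity

lemma inner_toLp {u v : Sp N → ℝ} (hu : MemLp u 2 (gaussMeasure N))
    (hv : MemLp v 2 (gaussMeasure N)) :
    inner ℝ (hu.toLp u) (hv.toLp v) = ∫ x, v x * u x ∂gaussMeasure N := by
  rw [L2.inner_def]
  apply integral_congr_ae
  filter_upwards [hu.coeFn_toLp, hv.coeFn_toLp] with x h₁ h₂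
  rw [h₁, h₂]
  simp

/-- The normalized Hermite polynomials. -/
def hermiteLp (α : Fin N → ℕ) : Lp ℝ 2 (gaussMeasure N) :=
  (√(hermiteNormSq α))⁻¹ • (memLp_hermiteFun α).toLp (hermiteFun α)

lemma inner_hermiteLp (α : Fin N → ℕ) {u : Sp N → ℝ} (hu : MemLp u 2 (gaussMeasure N)) :
    inner ℝ (hermiteLp α) (hu.toLp u) = (√(hermiteNormSq α))⁻¹ * hermiteCoeff u α := by
  rw [hermiteLp, real_inner_smul_left, inner_toLp, hermiteCoeff]

lemma orthonormal_hermiteLp : Orthonormal ℝ (hermiteLp (N := N)) := by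
  rw [orthonormal_iff_ite]
  intro α β
  conv_lhs => rw [hermiteLp.eq_def β]
  rw [real_inner_smul_right, inner_hermiteLp]
  split_ifs with h
  · subst h
    have h0 := Real.mul_self_sqrt (hermiteNormSq_pos α).le
    have h1 := (Real.sqrt_pos.2 (hermiteNormSq_pos α)).ne'
    rw [← hermiteNormSq, ← h0]
    simp only [Real.sqrt_mul_self (Real.sqrt_nonneg _)]
    field_simp
  · rw [hermiteCoeff_hermiteFun_of_ne (Ne.symm h)]
    simp

/-- The Hermite basis of the Gauss space. -/
def hermiteBasis (N : ℕ) : HilbertBasis (Fin N → ℕ) ℝ (Lp ℝ 2 (gaussMeasure N)) :=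
  HilbertBasis.mkOfOrthogonalEqBot orthonormal_hermiteLp <| by
    rw [Submodule.eq_bot_iff]
    intro f hf
    have hm : MemLp f 2 (gaussMeasure N) := Lp.memLp f
    have e : hm.toLp f = f := Lp.toLp_coeFn f hm
    rw [Lp.eq_zero_iff_ae_eq_zero]
    refine ae_eq_zero_of_hermiteCoeff_eq_zero hm.expIntegrable fun α => ?_
    have h1 := (Submodule.mem_orthogonal _ _).1 hf (hermiteLp α) (Submodule.subset_span ⟨α, rfl⟩)
    rw [← e, inner_hermiteLp] at h1
    have h2 := (Real.sqrt_pos.2 (hermiteNormSq_pos α)).ne'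
    exact (mul_eq_zero.1 h1).resolve_left (inv_ne_zero h2)

lemma hermiteBasis_apply (α : Fin N → ℕ) : hermiteBasis N α = hermiteLp α := by
  rw [hermiteBasis, HilbertBasis.coe_mkOfOrthogonalEqBot]

lemma inv_sqrt_hermiteNormSq_mul_self (α : Fin N → ℕ) :
    (√(hermiteNormSq α))⁻¹ * (√(hermiteNormSq α))⁻¹ = (hermiteNormSq α)⁻¹ := by
  rw [← mul_inv, Real.mul_self_sqrt (hermiteNormSq_pos α).le]

/-- Parseval's identity. -/
lemma hasSum_hermiteCoeff_mul {u v : Sp N → ℝ} (hu : MemLp u 2 (gaussMeasure N))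
    (hv : MemLp v 2 (gaussMeasure N)) :
    HasSum (fun α => hermiteCoeff u α * hermiteCoeff v α / hermiteNormSq α)
      (∫ x, u x * v x ∂gaussMeasure N) := by
  have h := (hermiteBasis N).hasSum_inner_mul_inner (hv.toLp v) (hu.toLp u)
  rw [inner_toLp] at h
  refine h.congr_fun fun α => ?_
  rw [hermiteBasis_apply, real_inner_comm, inner_hermiteLp, inner_hermiteLp, div_eq_mul_inv,
    ← inv_sqrt_hermiteNormSq_mul_self]
  ring

lemma summable_hermiteCoeff_sq {u : Sp N → ℝ} (hu : MemLp u 2 (gaussMeasure N)) :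
    Summable fun α => hermiteCoeff u α ^ 2 / hermiteNormSq α := by
  simpa only [sq] using (hasSum_hermiteCoeff_mul hu hu).summable

/-- The Riesz-Fischer theorem. -/
lemma exists_hermiteCoeff_eq (a : (Fin N → ℕ) → ℝ)
    (ha : Summable fun α => a α ^ 2 / hermiteNormSq α) :
    ∃ u : Sp N → ℝ, MemLp u 2 (gaussMeasure N) ∧ ∀ α, hermiteCoeff u α = a α := by
  have hmem : Memℓp (fun α => (√(hermiteNormSq α))⁻¹ * a α) 2 := by
    refine memℓp_gen ?_
    refine ha.congr fun α => ?_
    simp only [ENNReal.toReal_ofNat, Real.rpow_ofNat, Real.norm_eq_abs, sq_abs]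
    rw [mul_pow, sq (_⁻¹), inv_sqrt_hermiteNormSq_mul_self]
    ring
  let f := (hermiteBasis N).repr.symm ⟨_, hmem⟩
  have hm : MemLp f 2 (gaussMeasure N) := Lp.memLp f
  have e : hm.toLp f = f := Lp.toLp_coeFn f hm
  refine ⟨f, hm, fun α => ?_⟩
  have h1 : (hermiteBasis N).repr f α = (√(hermiteNormSq α))⁻¹ * a α := by
    simp only [f, LinearIsometryEquiv.apply_symm_apply]
  have h2 := (Real.sqrt_pos.2 (hermiteNormSq_pos α)).ne'
  rw [HilbertBasis.repr_apply_apply, hermiteBasis_apply, ← e, inner_hermiteLp] at h1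
  exact mul_left_cancel₀ (inv_ne_zero h2) h1

end HermiteBasis

/-! ### Weak derivatives in terms of Hermite coefficients -/

section Sobolev

variable {N : ℕ}

lemma memLp_div_gaussWeight {f : Sp N → ℝ} (hf : Continuous f) (hc : HasCompactSupport f) :
    MemLp (fun x => f x / gaussWeight x) 2 (gaussMeasure N) := by
  have h1 : Continuous fun x => f x / gaussWeight x :=
    hf.div continuous_gaussWeight fun x => (gaussWeight_pos x).ne'
  have h2 : HasCompactSupport fun x => f x / gaussWeight x := by
    simpa only [div_eq_mul_inv] using! hc.mul_right
  exact (h2.expBounded h1).memLp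

lemma integral_mul_div_gaussWeight (u f : Sp N → ℝ) :
    ∫ x, u x * (f x / gaussWeight x) ∂gaussMeasure N = ∫ x, u x * f x := by
  rw [integral_gaussMeasure]
  refine integral_congr_ae (Eventually.of_forall fun x => ?_)
  have := (gaussWeight_pos x).ne'
  simp only
  field_simp

lemma hermiteCoeff_div_gaussWeight (f : Sp N → ℝ) (α : Fin N → ℕ) :
    hermiteCoeff (fun x => f x / gaussWeight x) α = ∫ x, hermiteFun α x * f x := by
  rw [← integral_mul_div_gaussWeight]
  simp only [hermiteCoeff, mul_comm]

/-- For a test function `φ`, both `φ / w` and `∂_i φ / w` lie in `L²(γ)`, so Parseval expands the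
two sides of the weak derivative identity. The coefficients of `∂_i φ / w` are found by moving the
derivative onto `H_α`. -/
lemma hasWeakPartial_of_hermiteCoeff {i : Fin N} {u g : Sp N → ℝ}
    (hu : MemLp u 2 (gaussMeasure N)) (hg : MemLp g 2 (gaussMeasure N))
    (h : ∀ β, hermiteCoeff g β = hermiteCoeff u (β + Pi.single i 1)) : HasWeakPartial i u g := by
  refine ⟨hu.expIntegrable.locallyIntegrable, hg.expIntegrable.locallyIntegrable,
    fun φ hφ hc => ?_⟩
  have hd : Continuous fun x => fderiv ℝ φ x (EuclideanSpace.single i 1) :=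
    (hφ.continuous_fderiv (by simp)).clm_apply continuous_const
  have hdc : HasCompactSupport fun x => fderiv ℝ φ x (EuclideanSpace.single i 1) :=
    hc.fderiv_apply ℝ _
  have hA := hasSum_hermiteCoeff_mul hu (memLp_div_gaussWeight hd hdc)
  have hB := hasSum_hermiteCoeff_mul hg (memLp_div_gaussWeight hφ.continuous hc)
  have hcoeff : ∀ α : Fin N → ℕ,
      hermiteCoeff (fun x => fderiv ℝ φ x (EuclideanSpace.single i 1) / gaussWeight x) α
        = -(α i * hermiteCoeff (fun x => φ x / gaussWeight x) (α - Pi.single i 1)) := by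
    intro α
    rw [hermiteCoeff_div_gaussWeight, hermiteCoeff_div_gaussWeight,
      (hasWeakPartial_hermiteFun α i).3 φ hφ hc, ← integral_const_mul]
    simp only [mul_assoc]
  rw [integral_mul_div_gaussWeight] at hA hB
  -- Terms with `α_i = 0` vanish. For `α = β + e_i` the factor `α_i = β_i + 1` cancels against `n_α
  -- = (β_i + 1) n_β`.
  rw [← (add_single_injective i).hasSum_iff] at hA
  · refine hA.unique ?_
    refine hB.neg.congr_fun fun β => ?_
    simp only [Function.comp_apply, hcoeff, add_single_sub_single, hermiteNormSq_add_single, h,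
      Pi.add_apply, Pi.single_eq_same]
    have h1 := (hermiteNormSq_pos β).ne'
    have h2 : (β i : ℝ) + 1 ≠ 0 := by positivity
    push_cast
    field_simp
  · intro α hα
    rw [hcoeff, apply_eq_zero_of_notMem_range hα]
    simp

/-- The degree of a multi-index. -/
def deg (α : Fin N → ℕ) : ℕ := ∑ i, α i

lemma deg_add_single (β : Fin N → ℕ) (i : Fin N) : deg (β + Pi.single i 1) = deg β + 1 := by
  simp [deg, Finset.sum_add_distrib]

lemma deg_pos {α : Fin N → ℕ} (h : α ≠ 0) : 0 < deg α := by
  obtain ⟨i, hi⟩ := Function.ne_iff.1 h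
  exact (Nat.pos_of_ne_zero hi).trans_le
    (Finset.single_le_sum (f := α) (fun j _ => Nat.zero_le _) (Finset.mem_univ i))

/-- The Gauss-Sobolev space of order `k`, in terms of Hermite coefficients. -/
structure MemGaussH (k : ℕ) (u : Sp N → ℝ) : Prop where
  memLp : MemLp u 2 (gaussMeasure N)
  summable : Summable fun α : Fin N → ℕ =>
    (1 + deg α : ℝ) ^ k * (hermiteCoeff u α ^ 2 / hermiteNormSq α)

/-- The shifted coefficients define `g` by Riesz-Fischer. Passing from `n_{β+e_i}` to `n_β` costs
the factor `β_i + 1`, which is at most `1 + deg (β + e_i)` and is paid for by one power of the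
weight. -/
lemma MemGaussH.exists_hasWeakPartial {k : ℕ} {u : Sp N → ℝ} (h : MemGaussH (k + 1) u)
    (i : Fin N) : ∃ g, HasWeakPartial i u g ∧ MemGaussH k g := by
  have hs := h.summable.comp_injective (add_single_injective i)
  have hk : Summable fun β : Fin N → ℕ =>
      (1 + deg β : ℝ) ^ k * (hermiteCoeff u (β + Pi.single i 1) ^ 2 / hermiteNormSq β) := by
    refine Summable.of_nonneg_of_le (fun β => ?_) (fun β => ?_) hs
    · have := (hermiteNormSq_pos β).le
      positivity
    · simp only [Function.comp_apply, hermiteNormSq_add_single, deg_add_single]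
      have h1 := hermiteNormSq_pos β
      have h2 : (β i : ℝ) ≤ deg β := by
        exact_mod_cast Finset.single_le_sum (f := β) (fun j _ => Nat.zero_le _) (Finset.mem_univ i)
      have h3 : (0 : ℝ) < β i + 1 := by positivity
      have e : (1 + ((deg β + 1 : ℕ) : ℝ)) ^ (k + 1) *
          (hermiteCoeff u (β + Pi.single i 1) ^ 2 / ((β i + 1) * hermiteNormSq β))
          = ((1 + ((deg β + 1 : ℕ) : ℝ)) ^ k * ((1 + ((deg β + 1 : ℕ) : ℝ)) / (β i + 1))) *
            (hermiteCoeff u (β + Pi.single i 1) ^ 2 / hermiteNormSq β) := by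
        rw [pow_succ]
        field_simp
      rw [e]
      refine mul_le_mul_of_nonneg_right ?_ (by positivity)
      have h4 : 1 ≤ (1 + ((deg β + 1 : ℕ) : ℝ)) / (β i + 1) := by
        rw [one_le_div h3]
        push_cast
        linarith
      calc (1 + deg β : ℝ) ^ k ≤ (1 + ((deg β + 1 : ℕ) : ℝ)) ^ k := by
            gcongr
            omega
        _ ≤ _ := le_mul_of_one_le_right (by positivity) h4
  have h0 : Summable fun β : Fin N → ℕ =>
      hermiteCoeff u (β + Pi.single i 1) ^ 2 / hermiteNormSq β := by
    refine Summable.of_nonneg_of_le (fun β => ?_) (fun β => ?_) hk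
    · have := (hermiteNormSq_pos β).le
      positivity
    · have := (hermiteNormSq_pos β).le
      refine le_mul_of_one_le_left (by positivity) (one_le_pow₀ ?_)
      simp
  obtain ⟨g, hg, hgc⟩ := exists_hermiteCoeff_eq _ h0
  refine ⟨g, hasWeakPartial_of_hermiteCoeff h.memLp hg hgc, hg, ?_⟩
  simpa only [hgc] using hk

lemma MemGaussH.memHloc {k : ℕ} : ∀ {u : Sp N → ℝ}, MemGaussH k u → MemHloc k u := by
  induction k with
  | zero => exact fun h K hK => memLp_restrict_of_gaussMeasure h.memLp hK
  | succ k ih =>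
    intro u h
    refine ⟨fun K hK => memLp_restrict_of_gaussMeasure h.memLp hK, fun i => ?_⟩
    obtain ⟨g, hg, hg'⟩ := h.exists_hasWeakPartial i
    exact ⟨g, hg, ih hg'⟩

/-- A square integrable curl-free field has a square integrable potential. -/
lemma exists_potential {g : Fin N → Sp N → ℝ} (hg : ∀ i, MemLp (g i) 2 (gaussMeasure N))
    (h : ∀ i j (β : Fin N → ℕ),
      hermiteCoeff (g i) (β + Pi.single j 1) = hermiteCoeff (g j) (β + Pi.single i 1)) :
    ∃ u : Sp N → ℝ, MemLp u 2 (gaussMeasure N) ∧ ∀ i, HasWeakPartial i u (g i) := by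
  classical
  -- Any `i` with `α_i ≠ 0` prescribes the coefficient `c_{α-e_i}(g_i)`, and the curl condition
  -- makes the choice irrelevant. The coefficient at `α = 0` is the free additive constant, set to
  -- zero.
  let a : (Fin N → ℕ) → ℝ := fun α =>
    if hα : ∃ i, α i ≠ 0 then hermiteCoeff (g hα.choose) (α - Pi.single hα.choose 1) else 0
  have ha : ∀ α i, α i ≠ 0 → a α = hermiteCoeff (g i) (α - Pi.single i 1) := by
    intro α i hi
    have hα : ∃ i, α i ≠ 0 := ⟨i, hi⟩
    have e : a α = hermiteCoeff (g hα.choose) (α - Pi.single hα.choose 1) := dif_pos hα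
    rw [e]
    have hj := hα.choose_spec
    generalize hα.choose = j at hj
    by_cases hij : j = i
    · rw [hij]
    · have hi' : (α - Pi.single j 1 : Fin N → ℕ) i ≠ 0 := by simpa [Pi.single_eq_of_ne (Ne.symm hij)] using hi
      have hj' : (α - Pi.single i 1 : Fin N → ℕ) j ≠ 0 := by simpa [Pi.single_eq_of_ne hij] using hj
      rw [← sub_single_add_single hi', h, tsub_right_comm, sub_single_add_single hj']
  have ha' : ∀ β i, a (β + Pi.single i 1) = hermiteCoeff (g i) β := by
    intro β i
    rw [ha _ i (by simp), add_single_sub_single]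
  have hpart : ∀ i, Summable fun α : Fin N → ℕ => α i * (a α ^ 2 / hermiteNormSq α) := by
    intro i
    rw [← (add_single_injective i).summable_iff]
    · refine (summable_hermiteCoeff_sq (hg i)).congr fun β => ?_
      simp only [Function.comp_apply, ha', hermiteNormSq_add_single, Pi.add_apply,
        Pi.single_eq_same]
      have h1 := (hermiteNormSq_pos β).ne'
      have h2 : (β i : ℝ) + 1 ≠ 0 := by positivity
      push_cast
      field_simp
    · intro α hα
      rw [apply_eq_zero_of_notMem_range hα]
      simp
  -- This is the Gaussian Poincaré inequality in coefficients: `∑ α_i ≥ 1` for `α ≠ 0`, and `a 0 =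
  -- 0`.
  have hsum : Summable fun α => a α ^ 2 / hermiteNormSq α := by
    refine Summable.of_nonneg_of_le (fun α => ?_) (fun α => ?_)
      (summable_sum fun i (_ : i ∈ Finset.univ) => hpart i)
    · have := (hermiteNormSq_pos α).le
      positivity
    · have h0 : 0 ≤ a α ^ 2 / hermiteNormSq α := by
        have := (hermiteNormSq_pos α).le
        positivity
      rw [← Finset.sum_mul]
      by_cases hα : ∃ i, α i ≠ 0
      · refine le_mul_of_one_le_left h0 ?_
        have : 0 < deg α := deg_pos (Function.ne_iff.2 hα)
        exact_mod_cast this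
      · have : a α = 0 := dif_neg hα
        simp [this]
  obtain ⟨u, hu, huc⟩ := exists_hermiteCoeff_eq a hsum
  refine ⟨u, hu, fun i => hasWeakPartial_of_hermiteCoeff hu (hg i) fun β => ?_⟩
  rw [huc, ha']

end Sobolev

/-! ### The structure of the Gauss-Sobolev space -/

section Structure

variable {N : ℕ}

lemma mem_preSpace_of_memLp {u : Sp N → ℝ} {g : Fin N → Sp N → ℝ}
    (hg : ∀ i, MemLp (g i) 2 (gaussMeasure N)) (h : ∀ i, HasWeakPartial i u (g i))
    (hu : LocallyIntegrable u volume) : u ∈ preSpace N :=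
  ⟨hu, fun x => WithLp.toLp 2 fun i => g i x, h, MemLp.of_eval_piLp hg⟩

lemma memLp_weakGrad_apply (ψ : preSpace N) (i : Fin N) :
    MemLp (fun x => weakGrad ψ x i) 2 (gaussMeasure N) := (memLp_weakGrad ψ).eval_piLp i

/-- Functions with square integrable gradient are square integrable. -/
lemma memLp_preSpace (ψ : preSpace N) : MemLp (ψ : Sp N → ℝ) 2 (gaussMeasure N) := by
  have hw := hasWeakGradient_weakGrad ψ
  have hm := memLp_weakGrad_apply ψ
  -- The potential `u` of the gradient lies in `L²(γ)`, and `ψ - u` has zero weak gradient, hence is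
  -- constant.
  obtain ⟨u, hu, hug⟩ := exists_potential hm fun i j β =>
    (hw i).hermiteCoeff_rotate (hw j) (hm i).expIntegrable (hm j).expIntegrable β
  have hz : ∀ i, HasWeakPartial i (fun x => (ψ : Sp N → ℝ) x + (-1) * u x) (fun _ => 0) := by
    intro i
    have := (hw i).add ((hug i).smul (-1))
    simpa using this
  have hl : LocallyIntegrable (fun x => (-1) * u x) volume :=
    hu.expIntegrable.locallyIntegrable.smul (-1 : ℝ)
  obtain ⟨c, hc⟩ := ae_const_of_hasWeakPartial_zero (ψ := fun x => ψ.1 x + (-1) * u x)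
    (ψ.2.1.add hl) hz
  refine (hu.add (memLp_const c)).ae_eq (gaussMeasure_ac.ae_eq ?_)
  filter_upwards [hc] with x hx
  simp only [Pi.add_apply]
  linarith

lemma hermiteCoeff_weakGrad (ψ : preSpace N) (i : Fin N) (β : Fin N → ℕ) :
    hermiteCoeff (fun x => weakGrad ψ x i) β = hermiteCoeff ψ.1 (β + Pi.single i 1) :=
  (hasWeakGradient_weakGrad ψ i).hermiteCoeff_eq (memLp_preSpace ψ).expIntegrable
    (memLp_weakGrad_apply ψ i).expIntegrable β

/-- The number operator relation between the coefficients of a function and of its gradient. -/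
lemma sum_mul_hermiteCoeff_weakGrad (ψ : preSpace N) (α : Fin N → ℕ) :
    ∑ i, α i * hermiteCoeff (fun x => weakGrad ψ x i) (α - Pi.single i 1)
      = deg α * hermiteCoeff ψ.1 α := by
  rw [deg, Nat.cast_sum, Finset.sum_mul]
  refine Finset.sum_congr rfl fun i _ => ?_
  by_cases hi : α i = 0
  · simp [hi]
  · rw [hermiteCoeff_weakGrad, sub_single_add_single hi]

/-- Parseval for each `∂_i ψ`, reindexed by the shift, gives the series with the factor `α_i`; these
add up to `|α|`. -/
lemma summable_deg_mul_hermiteCoeff (ψ : preSpace N) :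
    Summable fun α => deg α * (hermiteCoeff ψ.1 α ^ 2 / hermiteNormSq α) := by
  have hpart : ∀ i, Summable fun α : Fin N → ℕ =>
      α i * (hermiteCoeff ψ.1 α ^ 2 / hermiteNormSq α) := by
    intro i
    rw [← (add_single_injective i).summable_iff]
    · refine (summable_hermiteCoeff_sq (memLp_weakGrad_apply ψ i)).congr fun β => ?_
      simp only [Function.comp_apply, hermiteCoeff_weakGrad, hermiteNormSq_add_single,
        Pi.add_apply, Pi.single_eq_same]
      have h1 := (hermiteNormSq_pos β).ne'
      have h2 : (β i : ℝ) + 1 ≠ 0 := by positivity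
      push_cast
      field_simp
    · intro α hα
      rw [apply_eq_zero_of_notMem_range hα]
      simp
  refine (summable_sum fun i (_ : i ∈ Finset.univ) => hpart i).congr fun α => ?_
  rw [← Finset.sum_mul, deg, Nat.cast_sum]

lemma inner_toClass_eq_sum (ψ φ : preSpace N) : inner ℝ (toClass ψ) (toClass φ)
    = ∑ i, ∫ x, weakGrad φ x i * weakGrad ψ x i ∂gaussMeasure N := by
  rw [inner_toClass, ← integral_finsetSum]
  · simp [PiLp.inner_apply]
  · exact fun i _ => (memLp_weakGrad_apply φ i).integrable_mul (memLp_weakGrad_apply ψ i)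

lemma hermiteFun_mem_preSpace (α : Fin N → ℕ) : hermiteFun α ∈ preSpace N :=
  mem_preSpace_of_memLp (fun _ => ((ExpBounded.const _).mul (expBounded_hermiteFun _)).memLp)
    (hasWeakPartial_hermiteFun α) (contDiff_hermiteFun α).continuous.locallyIntegrable

/-- The class of a Hermite polynomial. -/
def hermiteClass (α : Fin N → ℕ) : GaussSobolev N := toClass ⟨_, hermiteFun_mem_preSpace α⟩

lemma inner_hermiteClass (α : Fin N → ℕ) (ψ : preSpace N) :
    inner ℝ (hermiteClass α) (toClass ψ) = deg α * hermiteCoeff ψ.1 α := by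
  rw [hermiteClass, inner_toClass_eq_sum, ← sum_mul_hermiteCoeff_weakGrad]
  refine Finset.sum_congr rfl fun i _ => ?_
  rw [hermiteCoeff, ← integral_const_mul]
  refine integral_congr_ae (gaussMeasure_ac.ae_le ?_)
  filter_upwards [(hasWeakGradient_weakGrad ⟨_, hermiteFun_mem_preSpace α⟩ i).unique
    (hasWeakPartial_hermiteFun α i) (ae_eq_refl _)] with x hx
  rw [hx]
  ring

lemma isometry_grad : Isometry (grad (N := N)) := AddMonoidHomClass.isometry_of_norm _ fun _ => rfl

/-- The coefficients of a component of a field, as inner products. -/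
lemma exists_inner_eq_hermiteCoeff (i : Fin N) (α : Fin N → ℕ) :
    ∃ K : Lp (Sp N) 2 (gaussMeasure N), ∀ G : Lp (Sp N) 2 (gaussMeasure N),
      hermiteCoeff (fun x => G x i) α = inner ℝ K G := by
  have hm : MemLp (fun x => hermiteFun α x • (EuclideanSpace.single i 1 : Sp N)) 2
      (gaussMeasure N) := by
    refine MemLp.of_eval_piLp fun j => ?_
    by_cases hj : j = i
    · subst hj
      simpa using memLp_hermiteFun α
    · simp [hj]
  refine ⟨hm.toLp _, fun G => ?_⟩
  rw [L2.inner_def, hermiteCoeff]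
  apply integral_congr_ae
  filter_upwards [hm.coeFn_toLp] with x hx
  rw [hx, real_inner_smul_left, EuclideanSpace.inner_single_left]
  simp [mul_comm]

/-- The right-hand side is the curl-free condition in coefficients. It suffices for a potential, and
it consists of equations that are closed in `L²`. -/
lemma range_grad : Set.range (grad (N := N)) = {G | ∀ (i j : Fin N) (β : Fin N → ℕ),
    hermiteCoeff (fun x => G x i) (β + Pi.single j 1)
      = hermiteCoeff (fun x => G x j) (β + Pi.single i 1)} := by
  ext G
  constructor
  · rintro ⟨u, rfl⟩ i j β
    obtain ⟨ψ, rfl⟩ := toClass_surjective u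
    have e : ∀ k, (fun x => grad (toClass ψ) x k) =ᵐ[gaussMeasure N] fun x => weakGrad ψ x k := by
      intro k
      filter_upwards [(memLp_weakGrad ψ).coeFn_toLp] with x hx
      rw [grad_toClass, hx]
    rw [hermiteCoeff_congr (e i), hermiteCoeff_congr (e j), hermiteCoeff_weakGrad,
      hermiteCoeff_weakGrad, add_right_comm]
  · intro h
    have hm : ∀ i, MemLp (fun x => G x i) 2 (gaussMeasure N) := (Lp.memLp G).eval_piLp
    obtain ⟨u, hu, hug⟩ := exists_potential hm h
    have hp : u ∈ preSpace N :=
      mem_preSpace_of_memLp hm hug hu.expIntegrable.locallyIntegrable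
    refine ⟨toClass ⟨u, hp⟩, ?_⟩
    rw [grad_toClass]
    have e : weakGrad ⟨u, hp⟩ =ᵐ[gaussMeasure N] G := gaussMeasure_ac.ae_eq
      ((hasWeakGradient_weakGrad ⟨u, hp⟩).unique (G₂ := G) hug (ae_eq_refl _))
    exact Lp.ext ((memLp_weakGrad _).coeFn_toLp.trans e)

/-- The gradient is an isometry, and its range is an intersection of closed sets, each given by
equality of two continuous functionals. -/
instance : CompleteSpace (GaussSobolev N) := by
  rw [completeSpace_iff_isComplete_range isometry_grad.isUniformInducing, range_grad]
  apply IsClosed.isComplete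
  simp only [Set.ofPred_forall]
  refine isClosed_iInter fun i => isClosed_iInter fun j => isClosed_iInter fun β => ?_
  obtain ⟨K, hK⟩ := exists_inner_eq_hermiteCoeff i (β + Pi.single j 1)
  obtain ⟨L, hL⟩ := exists_inner_eq_hermiteCoeff j (β + Pi.single i 1)
  simp only [hK, hL]
  exact isClosed_eq (continuous_const.inner continuous_id) (continuous_const.inner continuous_id)

lemma toClass_congr {ψ φ : preSpace N} (c : ℝ)
    (h : (ψ : Sp N → ℝ) =ᵐ[volume] fun x => (φ : Sp N → ℝ) x + c) : toClass ψ = toClass φ := by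
  rw [← sub_eq_zero, ← map_sub, toClass_eq_zero_iff]
  refine ⟨c, ?_⟩
  filter_upwards [h] with x hx
  simp [hx]

lemma hermiteCoeff_const (c : ℝ) {α : Fin N → ℕ} (h : α ≠ 0) :
    hermiteCoeff (fun _ => c) α = 0 := by
  have e : (fun _ : Sp N => c) = fun x => c * hermiteFun 0 x := by
    simp [hermiteFun_zero]
  rw [e, hermiteCoeff_const_mul, hermiteCoeff_hermiteFun_of_ne (Ne.symm h), mul_zero]

/-- Every class has a representative with mean zero. -/
lemma exists_hermiteCoeff_zero_eq_zero (ψ : preSpace N) : ∃ φ : preSpace N,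
    toClass φ = toClass ψ ∧ hermiteCoeff φ.1 0 = 0 ∧
    ∀ α, α ≠ 0 → hermiteCoeff φ.1 α = hermiteCoeff ψ.1 α := by
  have hc : ∀ c : ℝ, (fun _ : Sp N => c) ∈ preSpace N := fun c =>
    ⟨locallyIntegrable_const c, fun _ => 0, fun i => hasWeakPartial_const i c, MemLp.zero'⟩
  let c : ℝ := -(hermiteCoeff ψ.1 0 / hermiteNormSq (0 : Fin N → ℕ))
  have hadd : ∀ α, hermiteCoeff (ψ + ⟨_, hc c⟩ : preSpace N).1 α
      = hermiteCoeff ψ.1 α + hermiteCoeff (fun _ => c) α := fun α =>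
    hermiteCoeff_add (memLp_preSpace ψ).expIntegrable (ExpBounded.const c).expIntegrable α
  refine ⟨ψ + ⟨_, hc c⟩, toClass_congr c (by rfl), ?_, fun α hα => ?_⟩
  · have e : (fun _ : Sp N => c) = fun x => c * hermiteFun 0 x := by
      simp [hermiteFun_zero]
    rw [hadd, e, hermiteCoeff_const_mul, ← hermiteNormSq]
    have := (hermiteNormSq_pos (0 : Fin N → ℕ)).ne'
    simp only [c]
    field_simp
    ring
  · rw [hadd, hermiteCoeff_const c hα, add_zero]

/-- The nonzero multi-indices. -/
abbrev NonzeroIndex (N : ℕ) : Type := {α : Fin N → ℕ // α ≠ 0}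

/-- The normalized classes of the Hermite polynomials. -/
def unitHermiteClass (α : NonzeroIndex N) : GaussSobolev N :=
  (√(deg α.1 * hermiteNormSq α.1))⁻¹ • hermiteClass α.1

lemma deg_mul_hermiteNormSq_pos (α : NonzeroIndex N) : 0 < deg α.1 * hermiteNormSq α.1 :=
  mul_pos (Nat.cast_pos.2 (deg_pos α.2)) (hermiteNormSq_pos _)

lemma inner_unitHermiteClass (α : NonzeroIndex N) (ψ : preSpace N) :
    inner ℝ (unitHermiteClass α) (toClass ψ)
      = (√(deg α.1 * hermiteNormSq α.1))⁻¹ * (deg α.1 * hermiteCoeff ψ.1 α.1) := by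
  rw [unitHermiteClass, real_inner_smul_left, inner_hermiteClass]

lemma orthonormal_unitHermiteClass : Orthonormal ℝ (unitHermiteClass (N := N)) := by
  rw [orthonormal_iff_ite]
  intro α β
  conv_lhs => rw [unitHermiteClass.eq_def β]
  rw [real_inner_smul_right, hermiteClass, inner_unitHermiteClass]
  split_ifs with h
  · subst h
    have h0 := Real.mul_self_sqrt (deg_mul_hermiteNormSq_pos α).le
    rw [← hermiteNormSq, ← mul_assoc, ← mul_inv, h0,
      inv_mul_cancel₀ (deg_mul_hermiteNormSq_pos α).ne']
  · rw [hermiteCoeff_hermiteFun_of_ne fun e => h (Subtype.ext e.symm)]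
    simp

/-- The Hermite basis of the Gauss-Sobolev space. -/
def sobolevBasis (N : ℕ) : HilbertBasis (NonzeroIndex N) ℝ (GaussSobolev N) :=
  HilbertBasis.mkOfOrthogonalEqBot orthonormal_unitHermiteClass <| by
    rw [Submodule.eq_bot_iff]
    intro u hu
    obtain ⟨ψ, rfl⟩ := toClass_surjective u
    -- Orthogonality controls only the coefficients with `α ≠ 0`. The remaining one is removed by
    -- changing the representative by a constant.
    obtain ⟨φ, hφ, h0, hne⟩ := exists_hermiteCoeff_zero_eq_zero ψ
    rw [← hφ, toClass_eq_zero_iff]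
    refine ⟨0, ac_gaussMeasure.ae_eq
      (ae_eq_zero_of_hermiteCoeff_eq_zero (memLp_preSpace φ).expIntegrable fun α => ?_)⟩
    by_cases hα : α = 0
    · rw [hα, h0]
    · have h1 := (Submodule.mem_orthogonal _ _).1 hu (unitHermiteClass ⟨α, hα⟩)
        (Submodule.subset_span ⟨_, rfl⟩)
      rw [inner_unitHermiteClass] at h1
      have h2 := (Real.sqrt_pos.2 (deg_mul_hermiteNormSq_pos ⟨α, hα⟩)).ne'
      have h3 : (deg α : ℝ) ≠ 0 := Nat.cast_ne_zero.2 (deg_pos hα).ne'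
      rw [hne α hα]
      exact (mul_eq_zero.1 ((mul_eq_zero.1 h1).resolve_left (inv_ne_zero h2))).resolve_left h3

lemma sobolevBasis_apply (α : NonzeroIndex N) : sobolevBasis N α = unitHermiteClass α := by
  rw [sobolevBasis, HilbertBasis.coe_mkOfOrthogonalEqBot]

end Structure

/-! ### The Ornstein-Uhlenbeck operator in the Hermite basis -/

section OrnsteinUhlenbeck

variable {N : ℕ}

/-- The series of `|α| c_α(f)² / n_α = |α|³ c_α(ψ)² / n_α` converges since `f` has finite gradient
norm. For `|α| ≥ 1` one has `(1 + |α|)³ ≤ 8 |α|³`, and the `L²` series of `ψ` covers `α = 0`. -/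
lemma memGaussH_of_hermiteCoeff {ψ f : preSpace N}
    (h : ∀ α, α ≠ 0 → hermiteCoeff f.1 α = deg α * hermiteCoeff ψ.1 α) :
    MemGaussH 3 (ψ : Sp N → ℝ) := by
  refine ⟨memLp_preSpace ψ, Summable.of_nonneg_of_le (fun α => ?_) (fun α => ?_)
    (((summable_deg_mul_hermiteCoeff f).mul_left 8).add
      (summable_hermiteCoeff_sq (memLp_preSpace ψ)))⟩
  · have := (hermiteNormSq_pos α).le
    positivity
  · have hn := hermiteNormSq_pos α
    by_cases hα : α = 0
    · subst hα
      simp [deg]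
    · have h1 : (1 : ℝ) ≤ deg α := by exact_mod_cast deg_pos hα
      rw [h α hα]
      have h2 : 0 ≤ hermiteCoeff ψ.1 α ^ 2 / hermiteNormSq α := by positivity
      have h3 : (1 + deg α : ℝ) ^ 3 ≤ (2 * deg α) ^ 3 := by
        gcongr
        linarith
      calc (1 + deg α : ℝ) ^ 3 * (hermiteCoeff ψ.1 α ^ 2 / hermiteNormSq α)
          ≤ (2 * deg α) ^ 3 * (hermiteCoeff ψ.1 α ^ 2 / hermiteNormSq α) :=
            mul_le_mul_of_nonneg_right h3 h2
        _ = 8 * (deg α * ((deg α * hermiteCoeff ψ.1 α) ^ 2 / hermiteNormSq α)) := by ring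
        _ ≤ _ := le_add_of_nonneg_right h2

/-- The expression `F` built from the weak derivatives of `ψ` has the same coefficients as `f`. As
`F` is exponentially integrable, which is all that completeness of the Hermite polynomials requires,
it equals `f`. -/
lemma isOrnsteinUhlenbeck_of_hermiteCoeff {ψ f : preSpace N} (hψ : MemGaussH 3 (ψ : Sp N → ℝ))
    (h : ∀ α, hermiteCoeff f.1 α = deg α * hermiteCoeff ψ.1 α) :
    IsOrnsteinUhlenbeck (ψ : Sp N → ℝ) f := by
  choose g hg hg' using hψ.exists_hasWeakPartial
  choose k hk hk' using fun i => (hg' i).exists_hasWeakPartial i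
  let F : Sp N → ℝ := fun x => -(∑ i, k i x) + ∑ i, x i * g i x
  have hx : ∀ i, ExpIntegrable fun x : Sp N => x i * g i x := fun i => by
    simpa only [mul_comm] using (hg' i).memLp.expIntegrable.mul (ExpBounded.coord i)
  have hF : ExpIntegrable F :=
    (ExpIntegrable.sum _ fun i _ => (hk' i).memLp.expIntegrable).neg.add
      (ExpIntegrable.sum _ fun i _ => hx i)
  have hOU : IsOrnsteinUhlenbeck (ψ : Sp N → ℝ) F := ⟨g, k, hg, hk, ae_eq_refl _⟩
  have hw := hasWeakGradient_weakGrad ψ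
  have hfi := (memLp_preSpace f).expIntegrable
  have hz := ae_eq_zero_of_hermiteCoeff_eq_zero (hfi.add hF.neg) fun α => by
    rw [hermiteCoeff_add hfi hF.neg, hermiteCoeff_neg, hOU.hermiteCoeff_eq hw
      (fun i => (memLp_weakGrad_apply ψ i).expIntegrable) hF, sum_mul_hermiteCoeff_weakGrad, h,
      add_neg_cancel]
  refine ⟨g, k, hg, hk, ?_⟩
  filter_upwards [ac_gaussMeasure.ae_le hz] with x hx
  exact add_neg_eq_zero.1 hx

lemma isDiagonal_ouOperator :
    IsDiagonal (ouOperator N) (sobolevBasis N) fun α => (deg α.1 : ℝ) := by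
  intro x y
  rw [ouOperator_graph]
  constructor
  · rintro ⟨ψ, f, -, hOU, rfl, rfl⟩ α
    rw [sobolevBasis_apply, inner_unitHermiteClass, inner_unitHermiteClass,
      hOU.hermiteCoeff_eq (hasWeakGradient_weakGrad ψ)
        (fun i => (memLp_weakGrad_apply ψ i).expIntegrable) (memLp_preSpace f).expIntegrable,
      sum_mul_hermiteCoeff_weakGrad]
    ring
  · intro h
    obtain ⟨ψ, rfl⟩ := toClass_surjective x
    obtain ⟨f₀, rfl⟩ := toClass_surjective y
    -- A function `-Δψ + x·∇ψ` has zero coefficient at `α = 0`, so the representative of `y` must be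
    -- the one of mean zero.
    obtain ⟨f, hf, hf0, -⟩ := exists_hermiteCoeff_zero_eq_zero f₀
    rw [← hf] at h ⊢
    have hc : ∀ α, α ≠ 0 → hermiteCoeff f.1 α = deg α * hermiteCoeff ψ.1 α := by
      intro α hα
      have h1 := h ⟨α, hα⟩
      rw [sobolevBasis_apply, inner_unitHermiteClass, inner_unitHermiteClass] at h1
      have h2 := inv_ne_zero (Real.sqrt_pos.2 (deg_mul_hermiteNormSq_pos ⟨α, hα⟩)).ne'
      have h3 : (deg α : ℝ) ≠ 0 := Nat.cast_ne_zero.2 (deg_pos hα).ne'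
      rw [mul_left_comm] at h1
      exact mul_left_cancel₀ h2 (mul_left_cancel₀ h3 h1)
    have hψ := memGaussH_of_hermiteCoeff hc
    refine ⟨ψ, f, hψ.memHloc, isOrnsteinUhlenbeck_of_hermiteCoeff hψ fun α => ?_, rfl, rfl⟩
    by_cases hα : α = 0
    · rw [hα, hf0]
      simp [deg]
    · exact hc α hα

lemma finite_setOf_deg_eq (n : ℕ) : {α : NonzeroIndex N | deg α.1 = n}.Finite := by
  have h : {α : Fin N → ℕ | deg α = n}.Finite := by
    refine (Set.finite_Iic fun _ : Fin N => n).subset fun α hα i => ?_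
    rw [← show deg α = n from hα]
    exact Finset.single_le_sum (f := α) (fun j _ => Nat.zero_le _) (Finset.mem_univ i)
  exact h.preimage Subtype.val_injective.injOn

lemma represents_hermiteFun_iff (u : GaussSobolev N) (α : Fin N → ℕ) :
    Represents u (hermiteFun α) ↔ u = hermiteClass α :=
  ⟨fun ⟨_, h⟩ => h.symm, fun h => ⟨hermiteFun_mem_preSpace α, h.symm⟩⟩

lemma hermiteClass_eq_smul (α : NonzeroIndex N) :
    hermiteClass α.1 = √(deg α.1 * hermiteNormSq α.1) • sobolevBasis N α := by
  rw [sobolevBasis_apply, unitHermiteClass,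
    smul_inv_smul₀ (Real.sqrt_pos.2 (deg_mul_hermiteNormSq_pos α)).ne']

lemma eigenspace_ouOperator {n : ℕ} (hn : 1 ≤ n) : eigenspace (ouOperator N) (n : ℝ) =
    Submodule.span ℝ {u | ∃ α : Fin N → ℕ, ∑ i, α i = n ∧ Represents u (hermiteFun α)} := by
  have hfin : {α : NonzeroIndex N | (deg α.1 : ℝ) = n}.Finite := by
    simpa only [Nat.cast_inj] using finite_setOf_deg_eq n
  rw [isDiagonal_ouOperator.eigenspace_eq_span _ hfin]
  apply le_antisymm
  · rw [Submodule.span_le]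
    rintro _ ⟨α, hα, rfl⟩
    rw [sobolevBasis_apply]
    refine Submodule.smul_mem _ _ (Submodule.subset_span ⟨α.1, Nat.cast_injective hα, ?_⟩)
    exact (represents_hermiteFun_iff _ _).2 rfl
  · rw [Submodule.span_le]
    rintro u ⟨α, hα, hu⟩
    rw [represents_hermiteFun_iff] at hu
    have hα0 : α ≠ 0 := by
      rintro rfl
      simp at hα
      omega
    rw [hu, hermiteClass_eq_smul ⟨α, hα0⟩]
    refine Submodule.smul_mem _ _ (Submodule.subset_span ⟨⟨α, hα0⟩, ?_, rfl⟩)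
    exact congrArg Nat.cast hα

lemma hermiteClass_ne_zero {α : Fin N → ℕ} (hα : α ≠ 0) : hermiteClass α ≠ 0 := by
  rw [hermiteClass_eq_smul ⟨α, hα⟩]
  exact smul_ne_zero (Real.sqrt_pos.2 (deg_mul_hermiteNormSq_pos ⟨α, hα⟩)).ne'
    ((sobolevBasis N).orthonormal.ne_zero _)

end OrnsteinUhlenbeck

end GaussSob

end

theorem theorem2 (N : ℕ) (hN : 1 ≤ N) :
    -- the Gauss-Sobolev space is a Hilbert space, and in it the operator is self-adjoint
    (∃ _ : CompleteSpace (GaussSob.GaussSobolev N), IsSelfAdjoint (GaussSob.ouOperator N)) ∧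
    -- the spectrum is purely discrete and consists of the positive integers
    GaussSob.HasPurelyDiscreteSpectrum (GaussSob.ouOperator N) ∧
    GaussSob.unboundedSpectrum (GaussSob.ouOperator N) = {z : ℝ | ∃ n : ℕ, 1 ≤ n ∧ (n : ℝ) = z} ∧
    -- every nonconstant Hermite polynomial is an eigenfunction
    (∀ α : Fin N → ℕ, α ≠ 0 → ∃ u : GaussSob.GaussSobolev N,
      GaussSob.Represents u (GaussSob.hermiteFun α) ∧ u ≠ 0 ∧
      u ∈ GaussSob.eigenspace (GaussSob.ouOperator N) ((∑ i, α i : ℕ) : ℝ)) ∧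
    -- the eigenspace of `n` is spanned by the Hermite polynomials of degree `n`
    ∀ n : ℕ, 1 ≤ n → GaussSob.eigenspace (GaussSob.ouOperator N) (n : ℝ) =
      Submodule.span ℝ {u | ∃ α : Fin N → ℕ, ∑ i, α i = n ∧
        GaussSob.Represents u (GaussSob.hermiteFun α)} := by
  refine ⟨⟨inferInstance, GaussSob.isDiagonal_ouOperator.isSelfAdjoint⟩,
    GaussSob.isDiagonal_ouOperator.hasPurelyDiscreteSpectrum GaussSob.finite_setOf_deg_eq, ?_,
    fun α hα => ?_, fun n hn => GaussSob.eigenspace_ouOperator hn⟩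
  · rw [GaussSob.isDiagonal_ouOperator.unboundedSpectrum_eq]
    ext z
    constructor
    · rintro ⟨α, rfl⟩
      exact ⟨_, GaussSob.deg_pos α.2, rfl⟩
    · rintro ⟨n, hn, rfl⟩
      -- The value `n` is attained by the power `n` of a single coordinate index, which exists
      -- because `N ≥ 1`.
      have hs : GaussSob.deg (Pi.single (⟨0, hN⟩ : Fin N) n) = n := by simp [GaussSob.deg]
      refine ⟨⟨Pi.single (⟨0, hN⟩ : Fin N) n, fun h => ?_⟩, congrArg Nat.cast hs⟩
      rw [Pi.single_eq_zero_iff] at h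
      omega
  · refine ⟨GaussSob.hermiteClass α, (GaussSob.represents_hermiteFun_iff _ _).2 rfl,
      GaussSob.hermiteClass_ne_zero hα, ?_⟩
    rw [GaussSob.eigenspace_ouOperator (n := ∑ i, α i) (GaussSob.deg_pos hα)]
    exact Submodule.subset_span ⟨α, rfl, (GaussSob.represents_hermiteFun_iff _ _).2 rfl⟩
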